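/- Let $F$ be a field of characteristic different from $2$ and $3$, and let $L=L_{\bar 0}\oplus L_{\bar 1}$ be a finite-dimensional nilpotent Lie superalgebra over $F$ of superdimension $(m\mid n)$, with derived subalgebra $L'=[L,L]$. Notation. $A(a\mid b)$ is the abelian Lie superalgebra of superdimension $(a\mid b)$. For $p,q\ge 0$, $H(p,q)$ is the Lie superalgebra with even basis $x_1,\dots,x_{2p},z$, odd basis $y_1,\dots,y_q$ and nonzero brackets $[x_i,x_{p+i}]=z=-[x_{p+i},x_i]$ $(1\le i\le p)$, $[y_j,y_j]=z$ $(1\le j\le q)$. For $p\ge 0$, $H_p$ is the Lie superalgebra with even basis $x_1,\dots,x_p$, odd basis $y_1,\dots,y_p,z$ and nonzero brackets $[x_i,y_i]=z=-[y_i,x_i]$ $(1\le i\le p)$. For a free presentation $0\to R\to\mathcal F\to L\to 0$ of $L$ (with $\mathcal F$ a free Lie superalgebra on a graded set), the Schur multiplier is $\mathcal M(L)=([\mathcal F,\mathcal F]\cap R)/[\mathcal F,R]$, and $$s(L)=\tfrac12(m+n-1)(m+n-2)+n+1-\dim\mathcal M(L).$$ (1) Suppose $\dim L'=(1\mid 0)$.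 If every element of $F$ is a square (for instance, if $F$ is algebraically closed), then there are non-negative integers $p,q$ with $p+q\ge 1$, $2p+1\le m$, $q\le n$ and $$L\cong H(p,q)\oplus A(m-2p-1\mid n-q).$$ Over any $F$ as above, whenever $L$ has such a decomposition with $(p,q)=(0,1)$ or $p+q\ge 2$, then for every free presentation of $L$ the multiplier $\mathcal M(L)$ is finite-dimensional and $s(L)=2$. (2) Suppose $\dim L'=(0\mid 1)$. Then there is an integer $p\ge 1$ with $p\le m$, $p+1\le n$ and $$L\cong H_p\oplus A(m-p\mid n-p-1).$$ Whenever $L$ has such a decomposition, then for every free presentation of $L$ the multiplier $\mathcal M(L)$ is finite-dimensional, $s(L)=3$ if $p\ge 2$, and $s(L)=2$ if $p=1$. -/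

import Mathlib

/-- A Lie superalgebra over `F`: a `ZMod 2`-graded vector space `L = gr 0 ⊕ gr 1` with a bilinear
bracket that respects the grading, is graded skew-symmetric and satisfies the graded Jacobi
identity. (These axioms are the usual ones when the characteristic is neither `2` nor `3`.) -/
class LieSuperalgebra (F : Type*) (L : Type*) [Field F] [AddCommGroup L] [Module F L] where
  /-- the homogeneous components: `gr 0` is the even part, `gr 1` the odd part -/
  gr : ZMod 2 → Submodule F L
  isCompl_gr : IsCompl (gr 0) (gr 1)
  /-- the bracket `[x, y]` -/
  br : L →ₗ[F] L →ₗ[F] L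
  br_mem : ∀ (a b : ZMod 2) (x y : L), x ∈ gr a → y ∈ gr b → br x y ∈ gr (a + b)
  br_skew : ∀ (a b : ZMod 2) (x y : L), x ∈ gr a → y ∈ gr b →
    br x y = -((-1 : F) ^ (a.val * b.val) • br y x)
  br_jacobi : ∀ (a b c : ZMod 2) (x y z : L), x ∈ gr a → y ∈ gr b → z ∈ gr c →
    (-1 : F) ^ (a.val * c.val) • br x (br y z) + (-1 : F) ^ (b.val * a.val) • br y (br z x)
      + (-1 : F) ^ (c.val * b.val) • br z (br x y) = 0

noncomputable section

namespace LieSuperalgebra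

section Basic

variable (F : Type*) (L : Type*) (M : Type*) [Field F]
  [AddCommGroup L] [Module F L] [LieSuperalgebra F L]
  [AddCommGroup M] [Module F M] [LieSuperalgebra F M]

/-- A homomorphism of Lie superalgebras: an even linear map that preserves brackets. -/
structure Hom extends L →ₗ[F] M where
  map_gr : ∀ (a : ZMod 2) (x : L), x ∈ gr (F := F) a → toFun x ∈ gr (F := F) a
  map_br : ∀ x y : L, toFun (br (F := F) x y) = br (F := F) (toFun x) (toFun y)

/-- An isomorphism of Lie superalgebras: a bijective homomorphism. -/
structure Iso extends L ≃ₗ[F] M where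
  map_gr : ∀ (a : ZMod 2) (x : L), x ∈ gr (F := F) a → toFun x ∈ gr (F := F) a
  map_br : ∀ x y : L, toFun (br (F := F) x y) = br (F := F) (toFun x) (toFun y)

variable {L} in
/-- `[I, J]`: the span of all brackets `[x, y]` with `x ∈ I` and `y ∈ J`. -/
def bracket (I J : Submodule F L) : Submodule F L := Submodule.map₂ (br (F := F)) I J

/-- The derived subalgebra `L' = [L, L]`. -/
def derived : Submodule F L := bracket F (⊤ : Submodule F L) ⊤

/-- The descending central sequence `C⁰ = L`, `Cᵏ⁺¹ = [Cᵏ, L]`. -/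
def centralSeries : ℕ → Submodule F L
  | 0 => ⊤
  | k + 1 => bracket F (centralSeries k) ⊤

/-- `L` is nilpotent if its descending central sequence reaches `0`. -/
def IsNilpotent : Prop := ∃ k, centralSeries F L k = ⊥

variable {L} in
/-- The graded subspace `U` has superdimension `(r ∣ s)`: its even part has dimension `r` and its
odd part has dimension `s`. Only used for subspaces of finite-dimensional spaces. -/
def HasSuperdim (U : Submodule F L) (r s : ℕ) : Prop :=
  Module.finrank F (U ⊓ gr 0 : Submodule F L) = r ∧
    Module.finrank F (U ⊓ gr 1 : Submodule F L) = s

/-- The direct sum of two Lie superalgebras. -/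
instance instProd : LieSuperalgebra F (L × M) where
  gr a := (gr a).prod (gr a)
  isCompl_gr := by
    have hL := isCompl_gr (F := F) (L := L)
    have hM := isCompl_gr (F := F) (L := M)
    rw [isCompl_iff, disjoint_iff, codisjoint_iff] at *
    refine ⟨?_, ?_⟩
    · rw [Submodule.prod_inf_prod, hL.1, hM.1, Submodule.prod_bot]
    · rw [Submodule.prod_sup_prod, hL.2, hM.2, Submodule.prod_top]
  br := LinearMap.mk₂ F (fun x y => (br (F := F) x.1 y.1, br (F := F) x.2 y.2))
    (by intros; simp) (by intros; simp) (by intros; simp) (by intros; simp)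
  br_mem a b x y hx hy := ⟨br_mem a b _ _ hx.1 hy.1, br_mem a b _ _ hx.2 hy.2⟩
  br_skew a b x y hx hy := by
    simp only [LinearMap.mk₂_apply]
    exact Prod.ext (br_skew a b _ _ hx.1 hy.1) (br_skew a b _ _ hx.2 hy.2)
  br_jacobi a b c x y z hx hy hz := by
    simp only [LinearMap.mk₂_apply]
    exact Prod.ext (br_jacobi a b c _ _ _ hx.1 hy.1 hz.1) (br_jacobi a b c _ _ _ hx.2 hy.2 hz.2)

end Basic

section Examples

variable (F : Type*) [Field F]

lemma isCompl_prod_fst_snd (V W : Type*) [AddCommGroup V] [Module F V]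
    [AddCommGroup W] [Module F W] :
    IsCompl ((⊤ : Submodule F V).prod (⊥ : Submodule F W)) ((⊥ : Submodule F V).prod ⊤) := by
  rw [isCompl_iff, disjoint_iff, codisjoint_iff, Submodule.prod_inf_prod, Submodule.prod_sup_prod]
  simp

/-- The grading of `V × W` with even part `V` and odd part `W`. -/
def stdGr (V W : Type*) [AddCommGroup V] [Module F V] [AddCommGroup W] [Module F W]
    (i : ZMod 2) : Submodule F (V × W) :=
  if i = 0 then (⊤ : Submodule F V).prod ⊥ else (⊥ : Submodule F V).prod ⊤

lemma zmod_two_cases (a : ZMod 2) : a = 0 ∨ a = 1 := by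
  revert a; decide

lemma mem_stdGr_zero {V W : Type*} [AddCommGroup V] [Module F V] [AddCommGroup W] [Module F W]
    (x : V × W) : x ∈ stdGr F V W 0 ↔ x.2 = 0 := by
  simp [stdGr, Submodule.mem_prod]

lemma mem_stdGr_one {V W : Type*} [AddCommGroup V] [Module F V] [AddCommGroup W] [Module F W]
    (x : V × W) : x ∈ stdGr F V W 1 ↔ x.1 = 0 := by
  simp [stdGr, Submodule.mem_prod]

/-- The abelian Lie superalgebra `A(a ∣ b)` of superdimension `(a ∣ b)`. -/
def Abelian (a b : ℕ) : Type _ := (Fin a → F) × (Fin b → F)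

instance (a b : ℕ) : AddCommGroup (Abelian F a b) :=
  inferInstanceAs (AddCommGroup ((Fin a → F) × (Fin b → F)))

instance (a b : ℕ) : Module F (Abelian F a b) :=
  inferInstanceAs (Module F ((Fin a → F) × (Fin b → F)))

instance (a b : ℕ) : LieSuperalgebra F (Abelian F a b) where
  gr := stdGr F (Fin a → F) (Fin b → F)
  isCompl_gr := isCompl_prod_fst_snd F (Fin a → F) (Fin b → F)
  br := 0
  br_mem _ _ _ _ _ _ := Submodule.zero_mem _
  br_skew _ _ _ _ _ _ := by simp
  br_jacobi _ _ _ _ _ _ _ _ _ := by simp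

/-- The underlying space of the Heisenberg Lie superalgebra `H(p, q)` with even centre.
The vector `((u, v, c), w)` stands for `∑ uᵢ xᵢ + ∑ vᵢ xₚ₊ᵢ + c z + ∑ wⱼ yⱼ`, where the `x`'s and
`z` are even and the `y`'s are odd. -/
def HeisEven (p q : ℕ) : Type _ := ((Fin p → F) × (Fin p → F) × F) × (Fin q → F)

instance (p q : ℕ) : AddCommGroup (HeisEven F p q) :=
  inferInstanceAs (AddCommGroup (((Fin p → F) × (Fin p → F) × F) × (Fin q → F)))

instance (p q : ℕ) : Module F (HeisEven F p q) :=
  inferInstanceAs (Module F (((Fin p → F) × (Fin p → F) × F) × (Fin q → F)))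

/-- The bracket of `H(p, q)`, that is the one with `[xᵢ, xₚ₊ᵢ] = z = -[xₚ₊ᵢ, xᵢ]`, `[yⱼ, yⱼ] = z`
and all other brackets of basis vectors equal to zero. -/
def heisEvenBr (p q : ℕ) :
    (((Fin p → F) × (Fin p → F) × F) × (Fin q → F)) →ₗ[F]
    (((Fin p → F) × (Fin p → F) × F) × (Fin q → F)) →ₗ[F]
    (((Fin p → F) × (Fin p → F) × F) × (Fin q → F)) :=
  LinearMap.mk₂ F
    (fun g h => ((0, 0, g.1.1 ⬝ᵥ h.1.2.1 - g.1.2.1 ⬝ᵥ h.1.1 + g.2 ⬝ᵥ h.2), 0))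
    (by intros; simp; ring) (by intros; simp; ring)
    (by intros; simp; ring) (by intros; simp; ring)

/-- The Lie superalgebra structure of `H(p, q)`. -/
abbrev heisEvenStruct (p q : ℕ) :
    LieSuperalgebra F (((Fin p → F) × (Fin p → F) × F) × (Fin q → F)) where
  gr := stdGr F ((Fin p → F) × (Fin p → F) × F) (Fin q → F)
  isCompl_gr := isCompl_prod_fst_snd F _ _
  br := heisEvenBr F p q
  br_mem a b x y hx hy := by
    obtain rfl | rfl := zmod_two_cases a <;> obtain rfl | rfl := zmod_two_cases b
    · exact (mem_stdGr_zero F _).2 rfl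
    · rw [mem_stdGr_zero] at hx
      rw [mem_stdGr_one] at hy
      rw [zero_add, mem_stdGr_one]
      simp [heisEvenBr, hx, hy]
    · rw [mem_stdGr_one] at hx
      rw [mem_stdGr_zero] at hy
      rw [add_zero, mem_stdGr_one]
      simp [heisEvenBr, hx, hy]
    · exact (mem_stdGr_zero F _).2 rfl
  br_skew a b x y hx hy := by
    obtain rfl | rfl := zmod_two_cases a <;> obtain rfl | rfl := zmod_two_cases b <;>
      simp only [mem_stdGr_zero, mem_stdGr_one] at hx hy <;>
      simp [heisEvenBr, hx, hy, dotProduct_comm, ZMod.val_one]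
  br_jacobi a b c x y z hx hy hz := by simp [heisEvenBr]

instance (p q : ℕ) : LieSuperalgebra F (HeisEven F p q) := heisEvenStruct F p q

/-- The underlying space of the Heisenberg Lie superalgebra `H_p` with odd centre.
The vector `(u, (v, c))` stands for `∑ uᵢ xᵢ + ∑ vᵢ yᵢ + c z`, where the `x`'s are even and the
`y`'s and `z` are odd. -/
def HeisOdd (p : ℕ) : Type _ := (Fin p → F) × ((Fin p → F) × F)

instance (p : ℕ) : AddCommGroup (HeisOdd F p) :=
  inferInstanceAs (AddCommGroup ((Fin p → F) × ((Fin p → F) × F)))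

instance (p : ℕ) : Module F (HeisOdd F p) :=
  inferInstanceAs (Module F ((Fin p → F) × ((Fin p → F) × F)))

/-- The bracket of `H_p`, that is the one with `[xᵢ, yᵢ] = z = -[yᵢ, xᵢ]` and all other brackets of
basis vectors equal to zero. -/
def heisOddBr (p : ℕ) :
    ((Fin p → F) × ((Fin p → F) × F)) →ₗ[F]
    ((Fin p → F) × ((Fin p → F) × F)) →ₗ[F]
    ((Fin p → F) × ((Fin p → F) × F)) :=
  LinearMap.mk₂ F
    (fun g h => (0, (0, g.1 ⬝ᵥ h.2.1 - g.2.1 ⬝ᵥ h.1)))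
    (by intros; simp; ring) (by intros; simp; ring)
    (by intros; simp; ring) (by intros; simp; ring)

/-- The Lie superalgebra structure of `H_p`. -/
abbrev heisOddStruct (p : ℕ) : LieSuperalgebra F ((Fin p → F) × ((Fin p → F) × F)) where
  gr := stdGr F (Fin p → F) ((Fin p → F) × F)
  isCompl_gr := isCompl_prod_fst_snd F _ _
  br := heisOddBr F p
  br_mem a b x y hx hy := by
    obtain rfl | rfl := zmod_two_cases a <;> obtain rfl | rfl := zmod_two_cases b
    · rw [mem_stdGr_zero] at hx hy
      rw [add_zero, mem_stdGr_zero]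
      simp [heisOddBr, hx, hy]
    · exact (mem_stdGr_one F _).2 rfl
    · exact (mem_stdGr_one F _).2 rfl
    · rw [mem_stdGr_one] at hx hy
      rw [show (1 : ZMod 2) + 1 = 0 from rfl, mem_stdGr_zero]
      simp [heisOddBr, hx, hy]
  br_skew a b x y hx hy := by
    obtain rfl | rfl := zmod_two_cases a <;> obtain rfl | rfl := zmod_two_cases b <;>
      simp only [mem_stdGr_zero, mem_stdGr_one] at hx hy <;>
      simp [heisOddBr, hx, hy, dotProduct_comm, ZMod.val_one]
  br_jacobi a b c x y z hx hy hz := by simp [heisOddBr]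

instance (p : ℕ) : LieSuperalgebra F (HeisOdd F p) := heisOddStruct F p

end Examples

section Free

variable (F : Type*) [Field F] (X₀ X₁ : Type*)

/-- The parity of a nonassociative monomial in even generators `X₀` and odd generators `X₁`. -/
def parity {X₀ X₁ : Type*} : FreeMagma (X₀ ⊕ X₁) → ZMod 2
  | .of (.inl _) => 0
  | .of (.inr _) => 1
  | .mul u v => parity u + parity v

/-- The homogeneous components of the free nonassociative algebra on `X₀ ⊕ X₁`. -/
def freeGr (a : ZMod 2) : Submodule F (FreeNonUnitalNonAssocAlgebra F (X₀ ⊕ X₁)) :=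
  Submodule.span F {f | ∃ w, parity w = a ∧ f = MonoidAlgebra.single w 1}

/-- Membership in the two-sided ideal of the free nonassociative algebra on `X₀ ⊕ X₁` generated by
the graded skew-symmetry and graded Jacobi relations. -/
inductive InRelIdeal : FreeNonUnitalNonAssocAlgebra F (X₀ ⊕ X₁) → Prop
  | skew (a b : ZMod 2) (x y : FreeNonUnitalNonAssocAlgebra F (X₀ ⊕ X₁))
      (hx : x ∈ freeGr F X₀ X₁ a) (hy : y ∈ freeGr F X₀ X₁ b) :
      InRelIdeal (x * y + (-1 : F) ^ (a.val * b.val) • (y * x))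
  | jacobi (a b c : ZMod 2) (x y z : FreeNonUnitalNonAssocAlgebra F (X₀ ⊕ X₁))
      (hx : x ∈ freeGr F X₀ X₁ a) (hy : y ∈ freeGr F X₀ X₁ b) (hz : z ∈ freeGr F X₀ X₁ c) :
      InRelIdeal ((-1 : F) ^ (a.val * c.val) • (x * (y * z))
        + (-1 : F) ^ (b.val * a.val) • (y * (z * x))
        + (-1 : F) ^ (c.val * b.val) • (z * (x * y)))
  | zero : InRelIdeal 0
  | add (x y : FreeNonUnitalNonAssocAlgebra F (X₀ ⊕ X₁)) :
      InRelIdeal x → InRelIdeal y → InRelIdeal (x + y)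
  | smul (c : F) (x : FreeNonUnitalNonAssocAlgebra F (X₀ ⊕ X₁)) :
      InRelIdeal x → InRelIdeal (c • x)
  | mul_left (x y : FreeNonUnitalNonAssocAlgebra F (X₀ ⊕ X₁)) :
      InRelIdeal y → InRelIdeal (x * y)
  | mul_right (x y : FreeNonUnitalNonAssocAlgebra F (X₀ ⊕ X₁)) :
      InRelIdeal x → InRelIdeal (x * y)

/-- The ideal of relations defining the free Lie superalgebra. -/
def relIdeal : Submodule F (FreeNonUnitalNonAssocAlgebra F (X₀ ⊕ X₁)) where
  carrier := {x | InRelIdeal F X₀ X₁ x}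
  zero_mem' := .zero
  add_mem' := .add _ _
  smul_mem' c x := .smul c x

/-- The free Lie superalgebra on the even generators `X₀` and the odd generators `X₁`: the quotient
of the free nonassociative algebra by the graded skew-symmetry and graded Jacobi relations. -/
def FreeLieSuperalgebra : Type _ :=
  FreeNonUnitalNonAssocAlgebra F (X₀ ⊕ X₁) ⧸ relIdeal F X₀ X₁

instance : AddCommGroup (FreeLieSuperalgebra F X₀ X₁) :=
  inferInstanceAs (AddCommGroup (_ ⧸ relIdeal F X₀ X₁))

instance : Module F (FreeLieSuperalgebra F X₀ X₁) :=
  inferInstanceAs (Module F (_ ⧸ relIdeal F X₀ X₁))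

variable {X₀ X₁}

/-- The quotient map from the free nonassociative algebra. -/
def freeMk : FreeNonUnitalNonAssocAlgebra F (X₀ ⊕ X₁) →ₗ[F] FreeLieSuperalgebra F X₀ X₁ :=
  (relIdeal F X₀ X₁).mkQ

lemma freeMk_surjective : Function.Surjective (freeMk F (X₀ := X₀) (X₁ := X₁)) :=
  Submodule.mkQ_surjective _

lemma freeMk_eq_zero (x : FreeNonUnitalNonAssocAlgebra F (X₀ ⊕ X₁)) :
    freeMk F x = 0 ↔ InRelIdeal F X₀ X₁ x :=
  Submodule.Quotient.mk_eq_zero _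

/-- The bracket of the free Lie superalgebra, induced by the nonassociative product. -/
def freeBr : FreeLieSuperalgebra F X₀ X₁ →ₗ[F] FreeLieSuperalgebra F X₀ X₁ →ₗ[F]
    FreeLieSuperalgebra F X₀ X₁ :=
  Submodule.liftQ (relIdeal F X₀ X₁)
    (LinearMap.mk₂ F
      (fun x => (Submodule.liftQ (relIdeal F X₀ X₁) ((freeMk F).comp (LinearMap.mulLeft F x))
        fun y hy => (freeMk_eq_zero F _).2 (.mul_left x y hy) :
          FreeLieSuperalgebra F X₀ X₁ →ₗ[F] FreeLieSuperalgebra F X₀ X₁))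
      (by
        intro x x' y
        obtain ⟨y, rfl⟩ := freeMk_surjective F y
        exact (congrArg (freeMk F) (add_mul x x' y)).trans (map_add _ _ _))
      (by
        intro c x y
        obtain ⟨y, rfl⟩ := freeMk_surjective F y
        exact (congrArg (freeMk F) (smul_mul_assoc c x y)).trans (map_smul _ _ _))
      (by intros; exact map_add _ _ _)
      (by intros; exact map_smul _ _ _))
    (by
      intro x hx
      ext y
      obtain ⟨y, rfl⟩ := freeMk_surjective F y
      exact (freeMk_eq_zero F _).2 (.mul_right x y hx))

lemma freeBr_mk (x y : FreeNonUnitalNonAssocAlgebra F (X₀ ⊕ X₁)) :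
    freeBr F (freeMk F x) (freeMk F y) = freeMk F (x * y) := rfl

lemma freeGr_mul {a b : ZMod 2} {x y : FreeNonUnitalNonAssocAlgebra F (X₀ ⊕ X₁)}
    (hx : x ∈ freeGr F X₀ X₁ a) (hy : y ∈ freeGr F X₀ X₁ b) :
    x * y ∈ freeGr F X₀ X₁ (a + b) := by
  induction hx, hy using Submodule.span_induction₂ with
  | mem_mem f g hf hg =>
    obtain ⟨u, rfl, rfl⟩ := hf
    obtain ⟨v, rfl, rfl⟩ := hg
    exact Submodule.subset_span ⟨u * v, rfl, by simp [MonoidAlgebra.single_mul_single]⟩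
  | zero_left => simp
  | zero_right => simp
  | add_left x y z _ _ _ h1 h2 => rw [add_mul]; exact add_mem h1 h2
  | add_right x y z _ _ _ h1 h2 => rw [mul_add]; exact add_mem h1 h2
  | smul_left r x y _ _ h => rw [smul_mul_assoc]; exact Submodule.smul_mem _ _ h
  | smul_right r x y _ _ h => rw [mul_smul_comm]; exact Submodule.smul_mem _ _ h

open Classical in
/-- The projection of the free nonassociative algebra onto its component of degree `a`. -/
def freeProj (a : ZMod 2) : FreeNonUnitalNonAssocAlgebra F (X₀ ⊕ X₁) →ₗ[F]
    FreeNonUnitalNonAssocAlgebra F (X₀ ⊕ X₁) where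
  toFun f := .ofCoeff (f.coeff.filter fun w => parity w = a)
  map_add' f g := by ext w; simp [Finsupp.filter_apply]
  map_smul' c f := by ext w; simp [Finsupp.filter_apply]

lemma freeProj_of_mem {a : ZMod 2} {x : FreeNonUnitalNonAssocAlgebra F (X₀ ⊕ X₁)}
    (hx : x ∈ freeGr F X₀ X₁ a) (b : ZMod 2) :
    freeProj F b x = if a = b then x else 0 := by
  induction hx using Submodule.span_induction with
  | mem f hf =>
    obtain ⟨u, rfl, rfl⟩ := hf
    ext w
    by_cases h : u = w
    · subst h; by_cases h' : parity u = b <;> simp [freeProj, h']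
    · by_cases h' : parity u = b <;> simp [freeProj, h', h]
  | zero => simp
  | add x y _ _ h1 h2 => rw [map_add, h1, h2]; split_ifs <;> simp
  | smul r x _ h => rw [map_smul, h]; split_ifs <;> simp

lemma exists_freeGr_add (x : FreeNonUnitalNonAssocAlgebra F (X₀ ⊕ X₁)) :
    ∃ x₀ ∈ freeGr F X₀ X₁ 0, ∃ x₁ ∈ freeGr F X₀ X₁ 1, x = x₀ + x₁ := by
  suffices h : x ∈ freeGr F X₀ X₁ 0 ⊔ freeGr F X₀ X₁ 1 by
    obtain ⟨y, hy, z, hz, h⟩ := Submodule.mem_sup.1 h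
    exact ⟨y, hy, z, hz, h.symm⟩
  rw [← MonoidAlgebra.sum_coeff_single x, Finsupp.sum]
  refine Submodule.sum_mem _ fun w _ => ?_
  rw [← mul_one (x.coeff w), ← smul_eq_mul, ← MonoidAlgebra.smul_single]
  refine Submodule.smul_mem _ _ ?_
  obtain h | h := zmod_two_cases (parity w)
  · exact Submodule.mem_sup_left (Submodule.subset_span ⟨w, h, rfl⟩)
  · exact Submodule.mem_sup_right (Submodule.subset_span ⟨w, h, rfl⟩)

lemma freeProj_mem (a : ZMod 2) (x : FreeNonUnitalNonAssocAlgebra F (X₀ ⊕ X₁)) :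
    freeProj F a x ∈ freeGr F X₀ X₁ a := by
  obtain ⟨x₀, h₀, x₁, h₁, rfl⟩ := exists_freeGr_add F x
  rw [map_add, freeProj_of_mem F h₀, freeProj_of_mem F h₁]
  obtain rfl | rfl := zmod_two_cases a <;> simp [h₀, h₁]

lemma freeProj_add (x : FreeNonUnitalNonAssocAlgebra F (X₀ ⊕ X₁)) :
    freeProj F 0 x + freeProj F 1 x = x := by
  obtain ⟨x₀, h₀, x₁, h₁, rfl⟩ := exists_freeGr_add F x
  simp [freeProj_of_mem F h₀, freeProj_of_mem F h₁]

lemma InRelIdeal.proj_of_mem {a : ZMod 2} {x : FreeNonUnitalNonAssocAlgebra F (X₀ ⊕ X₁)}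
    (hx : x ∈ freeGr F X₀ X₁ a) (h : InRelIdeal F X₀ X₁ x) (b : ZMod 2) :
    InRelIdeal F X₀ X₁ (freeProj F b x) := by
  rw [freeProj_of_mem F hx]
  split_ifs
  · exact h
  · exact .zero

lemma InRelIdeal.proj {x : FreeNonUnitalNonAssocAlgebra F (X₀ ⊕ X₁)}
    (h : InRelIdeal F X₀ X₁ x) (d : ZMod 2) : InRelIdeal F X₀ X₁ (freeProj F d x) := by
  induction h generalizing d with
  | skew a b x y hx hy =>
    refine InRelIdeal.proj_of_mem F (a := a + b) ?_ (.skew a b x y hx hy) d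
    exact add_mem (freeGr_mul F hx hy)
      (Submodule.smul_mem _ _ (add_comm a b ▸ freeGr_mul F hy hx))
  | jacobi a b c x y z hx hy hz =>
    refine InRelIdeal.proj_of_mem F (a := a + b + c) ?_ (.jacobi a b c x y z hx hy hz) d
    refine add_mem (add_mem (Submodule.smul_mem _ _ ?_) (Submodule.smul_mem _ _ ?_))
      (Submodule.smul_mem _ _ ?_)
    · have := freeGr_mul F hx (freeGr_mul F hy hz)
      rwa [← add_assoc] at this
    · have := freeGr_mul F hy (freeGr_mul F hz hx)
      rwa [show b + (c + a) = a + b + c by ring] at this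
    · have := freeGr_mul F hz (freeGr_mul F hx hy)
      rwa [show c + (a + b) = a + b + c by ring] at this
  | zero => rw [map_zero]; exact .zero
  | add x y _ _ h1 h2 => rw [map_add]; exact .add _ _ (h1 d) (h2 d)
  | smul c x _ h => rw [map_smul]; exact .smul _ _ (h d)
  | mul_left x y _ h =>
    have key (a b : ZMod 2) : InRelIdeal F X₀ X₁ (freeProj F d (freeProj F a x * freeProj F b y)) :=
      InRelIdeal.proj_of_mem F (freeGr_mul F (freeProj_mem F a x) (freeProj_mem F b y))
        (.mul_left _ _ (h b)) d
    rw [← freeProj_add F x, ← freeProj_add F y, add_mul, mul_add, mul_add, map_add, map_add,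
      map_add]
    exact .add _ _ (.add _ _ (key 0 0) (key 0 1)) (.add _ _ (key 1 0) (key 1 1))
  | mul_right x y _ h =>
    have key (a b : ZMod 2) : InRelIdeal F X₀ X₁ (freeProj F d (freeProj F a x * freeProj F b y)) :=
      InRelIdeal.proj_of_mem F (freeGr_mul F (freeProj_mem F a x) (freeProj_mem F b y))
        (.mul_right _ _ (h a)) d
    rw [← freeProj_add F x, ← freeProj_add F y, add_mul, mul_add, mul_add, map_add, map_add,
      map_add]
    exact .add _ _ (.add _ _ (key 0 0) (key 0 1)) (.add _ _ (key 1 0) (key 1 1))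

variable (X₀ X₁) in
instance : LieSuperalgebra F (FreeLieSuperalgebra F X₀ X₁) where
  gr a := (freeGr F X₀ X₁ a).map (freeMk F)
  isCompl_gr := by
    rw [isCompl_iff, Submodule.disjoint_def, codisjoint_iff, Submodule.eq_top_iff']
    refine ⟨?_, fun x => ?_⟩
    · rintro _ ⟨x, hx, rfl⟩ ⟨y, hy, hxy⟩
      have h : InRelIdeal F X₀ X₁ (x - y) := by
        rw [← freeMk_eq_zero, map_sub, hxy, sub_self]
      have h' := h.proj F 0
      rw [map_sub, freeProj_of_mem F hx, freeProj_of_mem F hy] at h'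
      rw [freeMk_eq_zero]
      simpa using h'
    · obtain ⟨x, rfl⟩ := freeMk_surjective F x
      obtain ⟨x₀, h₀, x₁, h₁, rfl⟩ := exists_freeGr_add F x
      rw [map_add]
      exact Submodule.add_mem_sup (Submodule.mem_map_of_mem h₀) (Submodule.mem_map_of_mem h₁)
  br := freeBr F
  br_mem := by
    rintro a b _ _ ⟨x, hx, rfl⟩ ⟨y, hy, rfl⟩
    rw [freeBr_mk]
    exact Submodule.mem_map_of_mem (freeGr_mul F hx hy)
  br_skew := by
    rintro a b _ _ ⟨x, hx, rfl⟩ ⟨y, hy, rfl⟩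
    rw [eq_neg_iff_add_eq_zero, freeBr_mk, freeBr_mk, ← map_smul, ← map_add, freeMk_eq_zero]
    exact .skew a b x y hx hy
  br_jacobi := by
    rintro a b c _ _ _ ⟨x, hx, rfl⟩ ⟨y, hy, rfl⟩ ⟨z, hz, rfl⟩
    simp only [freeBr_mk, ← map_smul, ← map_add, freeMk_eq_zero]
    exact .jacobi a b c x y z hx hy hz

end Free

section Lift

variable {F : Type*} [Field F] {X₀ X₁ : Type*}
  {L : Type*} [AddCommGroup L] [Module F L] [LieSuperalgebra F L]

/-- Evaluation of a nonassociative monomial in a Lie superalgebra. -/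
def evalMagma (f₀ : X₀ → gr (F := F) (L := L) 0) (f₁ : X₁ → gr (F := F) (L := L) 1) :
    FreeMagma (X₀ ⊕ X₁) → L
  | .of (.inl x) => f₀ x
  | .of (.inr x) => f₁ x
  | .mul u v => br (F := F) (evalMagma f₀ f₁ u) (evalMagma f₀ f₁ v)

lemma evalMagma_mem (f₀ : X₀ → gr (F := F) (L := L) 0) (f₁ : X₁ → gr (F := F) (L := L) 1) :
    ∀ w : FreeMagma (X₀ ⊕ X₁), evalMagma f₀ f₁ w ∈ gr (F := F) (L := L) (parity w)
  | .of (.inl x) => (f₀ x).2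
  | .of (.inr x) => (f₁ x).2
  | .mul u v => br_mem _ _ _ _ (evalMagma_mem f₀ f₁ u) (evalMagma_mem f₀ f₁ v)

/-- Evaluation of a nonassociative polynomial in a Lie superalgebra. -/
def evalFree (f₀ : X₀ → gr (F := F) (L := L) 0) (f₁ : X₁ → gr (F := F) (L := L) 1) :
    FreeNonUnitalNonAssocAlgebra F (X₀ ⊕ X₁) →ₗ[F] L where
  toFun x := Finsupp.linearCombination F (evalMagma f₀ f₁) x.coeff
  map_add' x y := by simp
  map_smul' c x := by simp

lemma evalFree_single (f₀ : X₀ → gr (F := F) (L := L) 0) (f₁ : X₁ → gr (F := F) (L := L) 1)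
    (w : FreeMagma (X₀ ⊕ X₁)) (c : F) :
    evalFree f₀ f₁ (MonoidAlgebra.single w c) = c • evalMagma f₀ f₁ w := by
  simp [evalFree]

lemma evalFree_mul (f₀ : X₀ → gr (F := F) (L := L) 0) (f₁ : X₁ → gr (F := F) (L := L) 1)
    (x y : FreeNonUnitalNonAssocAlgebra F (X₀ ⊕ X₁)) :
    evalFree f₀ f₁ (x * y) = br (F := F) (evalFree f₀ f₁ x) (evalFree f₀ f₁ y) := by
  rw [← MonoidAlgebra.sum_coeff_single x, ← MonoidAlgebra.sum_coeff_single y]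
  simp only [Finsupp.sum, Finset.sum_mul, Finset.mul_sum, map_sum, LinearMap.sum_apply,
    MonoidAlgebra.single_mul_single, evalFree_single, map_smul, LinearMap.smul_apply,
    Finset.smul_sum, smul_smul]
  refine Finset.sum_congr rfl fun v _ => Finset.sum_congr rfl fun u _ => ?_
  rw [mul_comm]
  rfl

lemma evalFree_mem (f₀ : X₀ → gr (F := F) (L := L) 0) (f₁ : X₁ → gr (F := F) (L := L) 1)
    {a : ZMod 2} {x : FreeNonUnitalNonAssocAlgebra F (X₀ ⊕ X₁)} (hx : x ∈ freeGr F X₀ X₁ a) :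
    evalFree f₀ f₁ x ∈ gr (F := F) (L := L) a := by
  induction hx using Submodule.span_induction with
  | mem f hf =>
    obtain ⟨w, rfl, rfl⟩ := hf
    rw [evalFree_single, one_smul]
    exact evalMagma_mem f₀ f₁ w
  | zero => simp
  | add x y _ _ h1 h2 => rw [map_add]; exact add_mem h1 h2
  | smul r x _ h => rw [map_smul]; exact Submodule.smul_mem _ _ h

lemma evalFree_eq_zero (f₀ : X₀ → gr (F := F) (L := L) 0) (f₁ : X₁ → gr (F := F) (L := L) 1)
    {x : FreeNonUnitalNonAssocAlgebra F (X₀ ⊕ X₁)} (h : InRelIdeal F X₀ X₁ x) :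
    evalFree f₀ f₁ x = 0 := by
  induction h with
  | skew a b x y hx hy =>
    rw [map_add, map_smul, evalFree_mul, evalFree_mul, ← eq_neg_iff_add_eq_zero]
    exact br_skew a b _ _ (evalFree_mem f₀ f₁ hx) (evalFree_mem f₀ f₁ hy)
  | jacobi a b c x y z hx hy hz =>
    simp only [map_add, map_smul, evalFree_mul]
    exact br_jacobi a b c _ _ _ (evalFree_mem f₀ f₁ hx) (evalFree_mem f₀ f₁ hy)
      (evalFree_mem f₀ f₁ hz)
  | zero => exact map_zero _
  | add x y _ _ h1 h2 => rw [map_add, h1, h2, add_zero]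
  | smul c x _ h => rw [map_smul, h, smul_zero]
  | mul_left x y _ h => rw [evalFree_mul, h, map_zero]
  | mul_right x y _ h => rw [evalFree_mul, h, map_zero, LinearMap.zero_apply]

/-- The universal property of the free Lie superalgebra: a degree-preserving map from the
generators to a Lie superalgebra extends to a homomorphism. -/
def lift (f₀ : X₀ → gr (F := F) (L := L) 0) (f₁ : X₁ → gr (F := F) (L := L) 1) :
    Hom F (FreeLieSuperalgebra F X₀ X₁) L where
  toLinearMap := (relIdeal F X₀ X₁).liftQ (evalFree f₀ f₁) fun _ h => evalFree_eq_zero f₀ f₁ h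
  map_gr := by
    rintro a _ ⟨x, hx, rfl⟩
    exact evalFree_mem f₀ f₁ hx
  map_br x y := by
    obtain ⟨x, rfl⟩ := freeMk_surjective F x
    obtain ⟨y, rfl⟩ := freeMk_surjective F y
    exact evalFree_mul f₀ f₁ x y

lemma lift_inl (f₀ : X₀ → gr (F := F) (L := L) 0) (f₁ : X₁ → gr (F := F) (L := L) 1) (x : X₀) :
    (lift f₀ f₁).toLinearMap (freeMk F (.of F (.inl x))) = f₀ x :=
  (evalFree_single f₀ f₁ (.of (.inl x)) 1).trans (one_smul _ _)

lemma lift_inr (f₀ : X₀ → gr (F := F) (L := L) 0) (f₁ : X₁ → gr (F := F) (L := L) 1) (x : X₁) :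
    (lift f₀ f₁).toLinearMap (freeMk F (.of F (.inr x))) = f₁ x :=
  (evalFree_single f₀ f₁ (.of (.inr x)) 1).trans (one_smul _ _)

end Lift

section Multiplier

universe w

variable (F : Type*) (L : Type*) [Field F] [AddCommGroup L] [Module F L] [LieSuperalgebra F L]

/-- A free presentation `0 → R → 𝓕 → L → 0`: a surjective homomorphism `ψ` from the free Lie
superalgebra `𝓕` on a graded set `X₀ ∪ X₁` onto `L`. -/
structure FreePresentation where
  /-- the even generators -/
  X₀ : Type w
  /-- the odd generators -/
  X₁ : Type w
  /-- the homomorphism onto `L` -/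
  ψ : Hom F (FreeLieSuperalgebra F X₀ X₁) L
  surjective : Function.Surjective ψ.toLinearMap

/-- Every Lie superalgebra has a free presentation, with all its homogeneous elements as
generators. -/
lemma nonempty_freePresentation {F : Type*} {L : Type w} [Field F] [AddCommGroup L] [Module F L]
    [LieSuperalgebra F L] : Nonempty (FreePresentation.{w} F L) := by
  refine ⟨⟨gr (F := F) (L := L) 0, gr (F := F) (L := L) 1, lift id id, fun x => ?_⟩⟩
  have hx : x ∈ gr (F := F) (L := L) 0 ⊔ gr 1 := by
    rw [(isCompl_gr (F := F) (L := L)).sup_eq_top]; trivial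
  obtain ⟨y, hy, z, hz, rfl⟩ := Submodule.mem_sup.1 hx
  exact ⟨freeMk F (.of F (.inl ⟨y, hy⟩)) + freeMk F (.of F (.inr ⟨z, hz⟩)), by
    rw [map_add, lift_inl, lift_inr]; rfl⟩

namespace FreePresentation

variable {F L} (P : FreePresentation F L)

/-- The kernel `R` of the presentation. -/
def R : Submodule F (FreeLieSuperalgebra F P.X₀ P.X₁) := LinearMap.ker P.ψ.toLinearMap

/-- `[𝓕, 𝓕] ∩ R`. -/
def derivedInfR : Submodule F (FreeLieSuperalgebra F P.X₀ P.X₁) :=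
  derived F (FreeLieSuperalgebra F P.X₀ P.X₁) ⊓ P.R

/-- The Schur multiplier `([𝓕, 𝓕] ∩ R) / [𝓕, R]` computed from the free presentation. -/
abbrev Multiplier : Type _ :=
  P.derivedInfR ⧸ (bracket F (⊤ : Submodule F (FreeLieSuperalgebra F P.X₀ P.X₁)) P.R).submoduleOf
    P.derivedInfR

/-- The invariant `s(L) = ½ (m + n - 1) (m + n - 2) + n + 1 - dim M(L)`, where `L` has
superdimension `(m ∣ n)`, computed from the free presentation. -/
def s : ℚ :=
  let m : ℚ := Module.finrank F (gr (F := F) (L := L) 0)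
  let n : ℚ := Module.finrank F (gr (F := F) (L := L) 1)
  (m + n - 1) * (m + n - 2) / 2 + n + 1 - Module.finrank F P.Multiplier

end FreePresentation

end Multiplier

end LieSuperalgebra

end

/-! Structure. When `L'` is a line spanned by a homogeneous `z`, nilpotency makes `z` central, so
the bracket is `B ⊗ z` for a bilinear form `B` whose degree is that of `z`. If `z` is even, `B` is
alternating on the even part, symmetric on the odd part and zero across. If `z` is odd, `B` only
pairs the even part with the odd part. Putting `B` in normal form gives the Heisenberg summand, and
a complement inside the radical, taken away from `z`, gives the abelian one. Square roots serve only
to diagonalize the symmetric form.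

Multiplier. Write `N = m + n`. For any free presentation, the dual of `[𝓕, 𝓕] / [𝓕, R]` is the space
of scalar 2-cocycles of `L`, of both parities (`finrank_cocycles_eq`). A cocycle gives a functional
because it defines a central extension, to which the free superalgebra maps. As `[𝓕, 𝓕] / [𝓕, R]` is
an extension of `L'` by the multiplier, `dim M(L) + dim L'` is the dimension of the cocycles
(`finrank_multiplier_add`).

Counting. Graded skew-symmetric forms have dimension `N (N - 1) / 2 + n`. All brackets lie on the
line of `z`, so the cocycle identity constrains only the values `f w z`. If it amounts to `f w z =
0` for `w` in a subspace `K` on which these values are independent, the cocycles have codimension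
`dim K` and `s(L) = dim K - N + 3` (`multiplier_of_derived_eq_span`). It remains to find `K`. Two
mutually orthogonal pairs with bracket `z`, or one odd `y` with `[y, y] = z`, force `f w z = 0` for
every `w`. For even `z` the value `f z z` vanishes anyway, so `K` is a hyperplane and `s = 2`. For
odd `z` the value `f z z` is a genuine condition, so `K = L` and `s = 3`. For odd `z` and `p = 1`
one value `f x z` stays free, so `K` is again a hyperplane and `s = 2`. -/

namespace LieSuperalgebra

/-! ### Normal forms of bilinear forms over a field. -/

section NormalForms

variable {F : Type*} [Field F] {V W U : Type*} [AddCommGroup V] [Module F V]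
  [AddCommGroup W] [Module F W] [AddCommGroup U] [Module F U]

/-- A surjection `g : V → U` extends to coordinates `V ≃ U × F ^ r`, where a vector `z` that is not
killed by `g` may be prescribed to lie in the first factor. -/
lemma exists_equiv_prod_of_surjective [FiniteDimensional F V] [FiniteDimensional F U]
    (g : V →ₗ[F] U) (hg : Function.Surjective g) (z : V) (hz : g z = 0 → z = 0) (r : ℕ)
    (hr : r = Module.finrank F V - Module.finrank F U) :
    ∃ e : V ≃ₗ[F] U × (Fin r → F), (∀ v, (e v).1 = g v) ∧ (e z).2 = 0 := by
  have hdisj : Disjoint (Submodule.span F {z}) (LinearMap.ker g) := by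
    rw [Submodule.disjoint_def]
    intro x hx hgx
    obtain ⟨c, rfl⟩ := Submodule.mem_span_singleton.1 hx
    rw [LinearMap.mem_ker, map_smul, smul_eq_zero] at hgx
    obtain h | h := hgx
    · rw [h, zero_smul]
    · rw [hz h, smul_zero]
  -- A complement of the kernel chosen to contain `z`: projecting onto the kernel along it kills
  -- `z`.
  obtain ⟨q, hzq, hq⟩ := hdisj.exists_isCompl
  have hk : Module.finrank F (LinearMap.ker g) = Module.finrank F (Fin r → F) := by
    have h := g.finrank_range_add_finrank_ker
    rw [LinearMap.range_eq_top.2 hg, finrank_top] at h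
    rw [Module.finrank_fin_fun]
    omega
  let e := LinearMap.equivProdOfSurjectiveOfIsCompl g
    ((LinearMap.ker g).projectionOnto q hq.symm)
    (LinearMap.range_eq_top.2 hg) (Submodule.range_projectionOnto hq.symm)
    (by rw [Submodule.ker_projectionOnto]; exact hq.symm)
  refine ⟨e.trans (LinearEquiv.prodCongr (LinearEquiv.refl F U) (LinearEquiv.ofFinrankEq _ _ hk)),
    fun v => rfl, ?_⟩
  have : (LinearMap.ker g).projectionOnto q hq.symm z = 0 :=
    (Submodule.projectionOnto_apply_eq_zero_iff hq.symm).2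
      (hzq (Submodule.mem_span_singleton_self z))
  exact (congrArg (LinearEquiv.ofFinrankEq _ _ hk) this).trans (map_zero _)

lemma finrank_range_lt_of_ker_lt [FiniteDimensional F V] {f g : V →ₗ[F] U}
    (h : LinearMap.ker f < LinearMap.ker g) :
    Module.finrank F (LinearMap.range g) < Module.finrank F (LinearMap.range f) := by
  have hf := f.finrank_range_add_finrank_ker
  have hg := g.finrank_range_add_finrank_ker
  have := Submodule.finrank_lt_finrank_of_lt h
  omega

lemma finrank_ker_add_one [FiniteDimensional F V] {ζ : V →ₗ[F] F} {z : V} (hz : ζ z = 1) :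
    Module.finrank F (LinearMap.ker ζ) + 1 = Module.finrank F V := by
  have h := ζ.finrank_range_add_finrank_ker
  have hr : LinearMap.range ζ = ⊤ :=
    LinearMap.range_eq_top.2 fun c => ⟨c • z, by rw [map_smul, hz, smul_eq_mul, mul_one]⟩
  rw [hr, finrank_top, Module.finrank_self] at h
  omega

/-- Induction on the rank: when `B x y = 1`, subtracting `B(·, y) ⊗ B(x, ·)` puts `x` into the left
kernel and so lowers the rank. The functionals `B(·, y)` and `B(x, ·)` become the new coordinates.
-/
lemma exists_pairing_normal_form [FiniteDimensional F V] (B : V →ₗ[F] W →ₗ[F] F) :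
    ∃ (p : ℕ) (X : V →ₗ[F] Fin p → F) (Y : W →ₗ[F] Fin p → F),
      Function.Surjective X ∧ Function.Surjective Y ∧ ∀ u v, B u v = X u ⬝ᵥ Y v := by
  induction hn : Module.finrank F (LinearMap.range B) using Nat.strong_induction_on
    generalizing B with
  | _ n ih =>
    by_cases hB : B = 0
    · subst hB
      exact ⟨0, 0, 0, Function.surjective_to_subsingleton _,
        Function.surjective_to_subsingleton _, fun u v => by simp⟩
    obtain ⟨x, y, hxy⟩ : ∃ x y, B x y = 1 := by
      by_contra! h
      refine hB (LinearMap.ext₂ fun x y => ?_)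
      by_contra hne
      exact h x ((B x y)⁻¹ • y) (by rw [map_smul, smul_eq_mul, inv_mul_cancel₀ hne])
    let B' : V →ₗ[F] W →ₗ[F] F := B - (B.flip y).smulRight (B x)
    have hB' (u v) : B' u v = B u v - B u y * B x v := rfl
    have hlt : LinearMap.ker B < LinearMap.ker B' := by
      refine lt_of_le_of_ne (fun u hu => ?_) fun h => ?_
      · have hu' : B u = 0 := hu
        exact LinearMap.ext fun v => by rw [hB', hu']; simp
      · have : x ∈ LinearMap.ker B' := LinearMap.ext fun v => by rw [hB', hxy]; simp
        rw [← h, LinearMap.mem_ker] at this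
        rw [this] at hxy
        simp at hxy
    obtain ⟨p, X, Y, hX, hY, hBXY⟩ := ih _ (hn ▸ finrank_range_lt_of_ker_lt hlt) B' rfl
    have hXx : X x = 0 := by
      refine dotProduct_eq_zero _ fun w => ?_
      obtain ⟨v, rfl⟩ := hY w
      rw [← hBXY, hB', hxy]; simp
    have hYy : Y y = 0 := by
      refine dotProduct_eq_zero _ fun w => ?_
      obtain ⟨v, rfl⟩ := hX w
      rw [dotProduct_comm, ← hBXY, hB', hxy]; simp
    refine ⟨p + 1, LinearMap.vecCons (B.flip y) X, LinearMap.vecCons (B x) Y, fun a => ?_,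
      fun a => ?_, fun u v => ?_⟩
    · obtain ⟨u, hu⟩ := hX (Fin.tail a)
      -- `X x = 0`, so a multiple of `x` adjusts the new coordinate and leaves the old ones alone.
      refine ⟨u + (a 0 - B u y) • x, ?_⟩
      refine funext fun i => Fin.cases ?_ (fun i => ?_) i
      · simp [hxy]
      · simp [hXx, hu, Fin.tail]
    · obtain ⟨u, hu⟩ := hY (Fin.tail a)
      refine ⟨u + (a 0 - B x u) • y, ?_⟩
      refine funext fun i => Fin.cases ?_ (fun i => ?_) i
      · simp [hxy]
      · simp [hYy, hu, Fin.tail]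
    · have := hBXY u v
      rw [hB', sub_eq_iff_eq_add] at this
      simp [this]; ring

/-- Gram–Schmidt by induction on the rank. A vector with `B x x = 1` exists because a nonzero
symmetric form has a non-isotropic vector by polarization (here `2 ≠ 0` enters), which a square root
normalizes. -/
lemma exists_symmetric_normal_form [FiniteDimensional F V] (h2 : (2 : F) ≠ 0)
    (hsq : ∀ c : F, IsSquare c) (B : V →ₗ[F] V →ₗ[F] F) (hB : ∀ u v, B u v = B v u) :
    ∃ (q : ℕ) (Y : V →ₗ[F] Fin q → F), Function.Surjective Y ∧ ∀ u v, B u v = Y u ⬝ᵥ Y v := by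
  induction hn : Module.finrank F (LinearMap.range B) using Nat.strong_induction_on
    generalizing B with
  | _ n ih =>
    by_cases h0 : B = 0
    · subst h0
      exact ⟨0, 0, Function.surjective_to_subsingleton _, fun u v => by simp⟩
    obtain ⟨x, hx⟩ : ∃ x, B x x = 1 := by
      by_contra! h
      have hd (x) : B x x = 0 := by
        by_contra hne
        obtain ⟨c, hc⟩ := hsq (B x x)
        have hc0 : c ≠ 0 := by rintro rfl; simp [hc] at hne
        refine h (c⁻¹ • x) ?_
        simp only [map_smul, LinearMap.smul_apply, smul_eq_mul, hc]
        field_simp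
      refine h0 (LinearMap.ext₂ fun x y => ?_)
      have := hd (x + y)
      simp only [map_add, LinearMap.add_apply, hd, hB y x, zero_add, add_zero] at this
      rw [← two_mul] at this
      exact (mul_eq_zero.1 this).resolve_left h2
    let B' : V →ₗ[F] V →ₗ[F] F := B - (B x).smulRight (B x)
    have hB' (u v) : B' u v = B u v - B x u * B x v := rfl
    have hlt : LinearMap.ker B < LinearMap.ker B' := by
      refine lt_of_le_of_ne (fun u hu => ?_) fun h => ?_
      · have hu' : B u = 0 := hu
        exact LinearMap.ext fun v => by rw [hB', hB x u, hu']; simp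
      · have : x ∈ LinearMap.ker B' := LinearMap.ext fun v => by rw [hB', hx]; simp
        rw [← h, LinearMap.mem_ker] at this
        rw [this] at hx
        simp at hx
    obtain ⟨q, Y, hY, hBY⟩ := ih _ (hn ▸ finrank_range_lt_of_ker_lt hlt) B'
      (fun u v => by rw [hB', hB', hB u v, mul_comm]) rfl
    have hYx : Y x = 0 := by
      refine dotProduct_eq_zero _ fun w => ?_
      obtain ⟨v, rfl⟩ := hY w
      rw [← hBY, hB', hx]; simp
    refine ⟨q + 1, LinearMap.vecCons (B x) Y, fun a => ?_, fun u v => ?_⟩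
    · obtain ⟨u, hu⟩ := hY (Fin.tail a)
      refine ⟨u + (a 0 - B x u) • x, ?_⟩
      refine funext fun i => Fin.cases ?_ (fun i => ?_) i
      · simp [hx]
      · simp [hYx, hu, Fin.tail]
    · have := hBY u v
      rw [hB', sub_eq_iff_eq_add] at this
      simp [this]; ring

lemma eq_zero_of_forall_dotProduct_sub {p : ℕ} {a b : Fin p → F}
    (h : ∀ c d : Fin p → F, a ⬝ᵥ d - b ⬝ᵥ c = 0) : a = 0 ∧ b = 0 :=
  ⟨dotProduct_eq_zero _ fun d => by simpa using h 0 d,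
    dotProduct_eq_zero _ fun c => by simpa using h c 0⟩

/-- A hyperbolic pair is split off at each step: subtracting its contribution puts both `x` and `y`
into the radical, and the rank drops. -/
lemma exists_alternating_normal_form [FiniteDimensional F V] (B : V →ₗ[F] V →ₗ[F] F)
    (hB : ∀ u, B u u = 0) :
    ∃ (p : ℕ) (X Y : V →ₗ[F] Fin p → F), Function.Surjective (X.prod Y) ∧
      ∀ u v, B u v = X u ⬝ᵥ Y v - Y u ⬝ᵥ X v := by
  induction hn : Module.finrank F (LinearMap.range B) using Nat.strong_induction_on
    generalizing B with
  | _ n ih =>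
    have hskew (u v) : B u v = -B v u := by
      have := hB (u + v)
      simp only [map_add, LinearMap.add_apply, hB, zero_add, add_zero] at this
      exact eq_neg_of_add_eq_zero_right this
    by_cases h0 : B = 0
    · subst h0
      exact ⟨0, 0, 0, Function.surjective_to_subsingleton _, fun u v => by simp⟩
    obtain ⟨x, y, hxy⟩ : ∃ x y, B x y = 1 := by
      by_contra! h
      refine h0 (LinearMap.ext₂ fun x y => ?_)
      by_contra hne
      exact h x ((B x y)⁻¹ • y) (by rw [map_smul, smul_eq_mul, inv_mul_cancel₀ hne])
    let B' : V →ₗ[F] V →ₗ[F] F := B - (B.flip y).smulRight (B x) + (B x).smulRight (B.flip y)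
    have hB' (u v) : B' u v = B u v - B u y * B x v + B x u * B v y := rfl
    have hyx : B y x = -1 := by rw [hskew, hxy]
    have hx' (v) : B' x v = 0 := by rw [hB', hxy, hB]; simp
    have hy' (v) : B' y v = 0 := by rw [hB', hxy, hB, hskew y v]; simp
    have hlt : LinearMap.ker B < LinearMap.ker B' := by
      refine lt_of_le_of_ne (fun u hu => ?_) fun h => ?_
      · have hu' : B u = 0 := hu
        exact LinearMap.ext fun v => by rw [hB', hskew x u, hu']; simp
      · have : x ∈ LinearMap.ker B' := LinearMap.ext fun v => hx' v
        rw [← h, LinearMap.mem_ker] at this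
        rw [this] at hxy
        simp at hxy
    obtain ⟨p, X, Y, hXY, hBXY⟩ := ih _ (hn ▸ finrank_range_lt_of_ker_lt hlt) B'
      (fun u => by rw [hB', hB]; ring) rfl
    have hz {w : V} (hw : ∀ v, B' w v = 0) : X w = 0 ∧ Y w = 0 := by
      refine eq_zero_of_forall_dotProduct_sub fun c d => ?_
      obtain ⟨v, hv⟩ := hXY (c, d)
      replace hv : X v = c ∧ Y v = d := Prod.ext_iff.1 hv
      rw [← hv.1, ← hv.2, ← hBXY, hw]
    obtain ⟨hXx, hYx⟩ := hz hx'
    obtain ⟨hXy, hYy⟩ := hz hy'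
    refine ⟨p + 1, LinearMap.vecCons (B.flip y) X, LinearMap.vecCons (B x) Y, fun a => ?_,
      fun u v => ?_⟩
    · obtain ⟨u, hu⟩ := hXY (Fin.tail a.1, Fin.tail a.2)
      replace hu : X u = Fin.tail a.1 ∧ Y u = Fin.tail a.2 := Prod.ext_iff.1 hu
      refine ⟨u + (a.1 0 - B u y) • x + (a.2 0 - B x u) • y, ?_⟩
      refine Prod.ext (funext fun i => Fin.cases ?_ (fun i => ?_) i)
        (funext fun i => Fin.cases ?_ (fun i => ?_) i)
      · simp [hxy, hB]
      · simp [hXx, hXy, hu, Fin.tail]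
      · simp [hxy, hB]
      · simp [hYx, hYy, hu, Fin.tail]
    · have := hBXY u v
      rw [hB'] at this
      have e : B u v = X u ⬝ᵥ Y v - Y u ⬝ᵥ X v + B u y * B x v - B x u * B v y := by
        rw [← this]; ring
      simp [e]; ring

end NormalForms

/-! ### Homogeneous components and homogeneous bases. -/

section Grading

variable {F : Type*} {L : Type*} [Field F] [AddCommGroup L] [Module F L] [LieSuperalgebra F L]

variable (F L) in
/-- The projection of a Lie superalgebra onto its homogeneous component of degree `a`. -/
noncomputable def grProj (a : ZMod 2) : L →ₗ[F] L :=
  if a = 0 then (gr (F := F) (L := L) 0).projection (gr 1) isCompl_gr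
  else (gr (F := F) (L := L) 1).projection (gr 0) isCompl_gr.symm

lemma grProj_mem (a : ZMod 2) (x : L) : grProj F L a x ∈ gr (F := F) (L := L) a := by
  obtain rfl | rfl := zmod_two_cases a <;> simp [grProj]

lemma grProj_add (x : L) : grProj F L 0 x + grProj F L 1 x = x := by
  simp [grProj, Submodule.projection_add_projection_eq_self]

lemma grProj_of_mem {a : ZMod 2} {x : L} (hx : x ∈ gr (F := F) (L := L) a) (b : ZMod 2) :
    grProj F L b x = if a = b then x else 0 := by
  obtain rfl | rfl := zmod_two_cases a <;> obtain rfl | rfl := zmod_two_cases b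
  · simpa [grProj] using hx
  · simpa [grProj] using hx
  · simpa [grProj] using hx
  · simpa [grProj] using hx

lemma grProj_self {a : ZMod 2} {x : L} (hx : x ∈ gr (F := F) (L := L) a) :
    grProj F L a x = x := by rw [grProj_of_mem hx, if_pos rfl]

variable (F) in
lemma gr_induction {p : L → Prop} (x : L)
    (hom : ∀ (a : ZMod 2) (x : L), x ∈ gr (F := F) (L := L) a → p x)
    (add : ∀ x y : L, p x → p y → p (x + y)) : p x := by
  rw [← grProj_add (F := F) x]
  exact add _ _ (hom 0 _ (grProj_mem 0 x)) (hom 1 _ (grProj_mem 1 x))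

lemma exists_gr_basis [FiniteDimensional F L] :
    ∃ b : Module.Basis (Fin (Module.finrank F (gr (F := F) (L := L) 0)) ⊕
        Fin (Module.finrank F (gr (F := F) (L := L) 1))) F L,
      ∀ i, b i ∈ gr (F := F) (L := L) (Sum.elim (fun _ => 0) (fun _ => 1) i) := by
  refine ⟨((Module.finBasis F (gr (F := F) (L := L) 0)).prod
    (Module.finBasis F (gr (F := F) (L := L) 1))).map
    (Submodule.prodEquivOfIsCompl _ _ isCompl_gr), ?_⟩
  rintro (i | i) <;> simp

lemma finrank_gr_add [FiniteDimensional F L] :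
    Module.finrank F (gr (F := F) (L := L) 0) + Module.finrank F (gr (F := F) (L := L) 1) =
      Module.finrank F L := by
  rw [← (Submodule.prodEquivOfIsCompl _ _ (isCompl_gr (F := F) (L := L))).finrank_eq,
    Module.finrank_prod]

lemma gr_le_span_of_basis {ι : Type*} (b : Module.Basis ι F L) (π : ι → ZMod 2)
    (hb : ∀ i, b i ∈ gr (F := F) (L := L) (π i)) (a : ZMod 2) :
    gr (F := F) (L := L) a ≤ Submodule.span F (b '' {i | π i = a}) := by
  intro x hx
  rw [← grProj_self hx, ← b.linearCombination_repr x, Finsupp.linearCombination_apply,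
    Finsupp.sum, map_sum]
  refine Submodule.sum_mem _ fun i _ => ?_
  rw [map_smul, grProj_of_mem (hb i)]
  split_ifs with h
  · exact Submodule.smul_mem _ _ (Submodule.subset_span ⟨i, h, rfl⟩)
  · simp

end Grading

/-! ### The dimension of the space of graded skew-symmetric forms. -/

section SuperSkew

set_option maxSynthPendingDepth 3

variable (F : Type*) (L : Type*) [Field F] [AddCommGroup L] [Module F L] [LieSuperalgebra F L]

/-- The graded skew-symmetric bilinear forms on `L`. -/
def superSkew : Submodule F (L →ₗ[F] L →ₗ[F] F) where
  carrier := {f | ∀ (a b : ZMod 2) (x y : L), x ∈ gr (F := F) a → y ∈ gr (F := F) b →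
    f x y = -((-1 : F) ^ (a.val * b.val) * f y x)}
  zero_mem' := by simp
  add_mem' hf hg a b x y hx hy := by
    simp only [LinearMap.add_apply, hf a b x y hx hy, hg a b x y hx hy]; ring
  smul_mem' c f hf a b x y hx hy := by
    simp only [LinearMap.smul_apply, smul_eq_mul, hf a b x y hx hy]; ring

/-- The scalar-valued `2`-cocycles on `L`. -/
def cocycles : Submodule F (L →ₗ[F] L →ₗ[F] F) where
  carrier := {f | f ∈ superSkew F L ∧ ∀ (a b c : ZMod 2) (x y z : L), x ∈ gr (F := F) a →
    y ∈ gr (F := F) b → z ∈ gr (F := F) c →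
    (-1 : F) ^ (a.val * c.val) * f x (br (F := F) y z)
      + (-1 : F) ^ (b.val * a.val) * f y (br (F := F) z x)
      + (-1 : F) ^ (c.val * b.val) * f z (br (F := F) x y) = 0}
  zero_mem' := ⟨zero_mem _, by intros; simp⟩
  add_mem' hf hg := ⟨add_mem hf.1 hg.1, fun a b c x y z hx hy hz => by
    have h1 := hf.2 a b c x y z hx hy hz
    have h2 := hg.2 a b c x y z hx hy hz
    simp only [LinearMap.add_apply]
    linear_combination h1 + h2⟩
  smul_mem' r f hf := ⟨Submodule.smul_mem _ _ hf.1, fun a b c x y z hx hy hz => by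
    have h1 := hf.2 a b c x y z hx hy hz
    simp only [LinearMap.smul_apply, smul_eq_mul]
    linear_combination r * h1⟩

variable {F L}

lemma mem_superSkew_of_basis {ι : Type*} (b : Module.Basis ι F L) (π : ι → ZMod 2)
    (hb : ∀ i, b i ∈ gr (F := F) (L := L) (π i)) {f : L →ₗ[F] L →ₗ[F] F}
    (hf : ∀ i j, f (b i) (b j) = -((-1 : F) ^ ((π i).val * (π j).val) * f (b j) (b i))) :
    f ∈ superSkew F L := by
  intro a c x y hx hy
  replace hx := gr_le_span_of_basis b π hb a hx
  replace hy := gr_le_span_of_basis b π hb c hy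
  induction hx, hy using
    Submodule.span_induction₂ with
  | mem_mem x y hx hy =>
    obtain ⟨i, rfl, rfl⟩ := hx
    obtain ⟨j, rfl, rfl⟩ := hy
    exact hf i j
  | zero_left => simp
  | zero_right => simp
  | add_left x y z _ _ _ h1 h2 => simp only [map_add, LinearMap.add_apply, h1, h2]; ring
  | add_right x y z _ _ _ h1 h2 => simp only [map_add, LinearMap.add_apply, h1, h2]; ring
  | smul_left r x y _ _ h => simp only [map_smul, LinearMap.smul_apply, smul_eq_mul, h]; ring
  | smul_right r x y _ _ h => simp only [map_smul, LinearMap.smul_apply, smul_eq_mul, h]; ring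

/-- The positions of the independent coefficients of a graded skew-symmetric form. -/
abbrev SkewIndex {ι : Type*} [LinearOrder ι] (π : ι → ZMod 2) : Type _ :=
  {p : ι × ι // p.1 < p.2 ∨ p.1 = p.2 ∧ π p.1 = 1}

/-- All pairs of indices are counted by trichotomy, the two off-diagonal halves being exchanged by
the swap. The additive form avoids division and truncated subtraction. -/
lemma card_skewIndex {ι : Type*} [LinearOrder ι] [Fintype ι] (π : ι → ZMod 2) :
    2 * Fintype.card (SkewIndex π) + Fintype.card ι =
      Fintype.card ι * Fintype.card ι + 2 * Fintype.card {i // π i = 1} := by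
  have h1 : Fintype.card (SkewIndex π) =
      ∑ p : ι × ι, ((if p.1 < p.2 then 1 else 0) + if p.1 = p.2 ∧ π p.1 = 1 then 1 else 0) := by
    rw [Fintype.card_subtype, Finset.card_filter]
    refine Finset.sum_congr rfl fun p _ => ?_
    by_cases h : p.1 < p.2
    · simp [h, h.ne]
    · simp [h]
  have h2 : ∑ p : ι × ι, (if p.1 = p.2 ∧ π p.1 = 1 then 1 else 0) =
      Fintype.card {i // π i = 1} := by
    rw [Fintype.card_subtype, Finset.card_filter, Fintype.sum_prod_type]
    refine Finset.sum_congr rfl fun i _ => ?_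
    simp [ite_and]
  have h3 : ∑ p : ι × ι, (if p.2 < p.1 then 1 else 0) =
      ∑ p : ι × ι, (if p.1 < p.2 then 1 else 0) :=
    (Equiv.prodComm ι ι).sum_comp fun p : ι × ι => if p.1 < p.2 then 1 else 0
  have h4 : ∑ p : ι × ι, (if p.1 = p.2 then 1 else 0) = Fintype.card ι := by
    rw [Fintype.sum_prod_type]; simp
  have h5 : Fintype.card ι * Fintype.card ι = ∑ p : ι × ι, ((if p.2 < p.1 then 1 else 0) +
      (if p.1 < p.2 then 1 else 0) + if p.1 = p.2 then 1 else 0) := by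
    rw [← Fintype.card_prod, ← Finset.card_univ, Finset.card_eq_sum_ones]
    refine Finset.sum_congr rfl fun p _ => ?_
    obtain h | h | h := lt_trichotomy p.1 p.2
    · simp [h, h.ne, h.not_gt]
    · simp [h]
    · simp [h, h.ne', h.not_gt]
  rw [Finset.sum_add_distrib, h2] at h1
  rw [Finset.sum_add_distrib, Finset.sum_add_distrib, h3, h4] at h5
  omega

/-- The values above the diagonal and on the odd diagonal can be prescribed freely and determine the
form; on the even diagonal skew-symmetry and `2 ≠ 0` force zero. -/
lemma finrank_superSkew_of_basis (h2 : (2 : F) ≠ 0) {ι : Type*} [LinearOrder ι] [Fintype ι]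
    (b : Module.Basis ι F L) (π : ι → ZMod 2) (hb : ∀ i, b i ∈ gr (F := F) (L := L) (π i)) :
    Module.finrank F (superSkew F L) = Fintype.card (SkewIndex π) := by
  let Φ : superSkew F L →ₗ[F] (SkewIndex π → F) :=
    { toFun := fun f p => f.1 (b p.1.1) (b p.1.2)
      map_add' := fun _ _ => rfl
      map_smul' := fun _ _ => rfl }
  have hinj : Function.Injective Φ := by
    refine (injective_iff_map_eq_zero Φ).2 fun f hf => Subtype.ext ?_
    have hlt {i j : ι} (h : i < j) : f.1 (b i) (b j) = 0 := congrFun hf ⟨(i, j), .inl h⟩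
    refine b.ext fun i => b.ext fun j => ?_
    obtain h | rfl | h := lt_trichotomy i j
    · exact hlt h
    · obtain h | h := zmod_two_cases (π i)
      · have := f.2 0 0 (b i) (b i) (h ▸ hb i) (h ▸ hb i)
        simp only [ZMod.val_zero, mul_zero, pow_zero, one_mul] at this
        rw [eq_neg_iff_add_eq_zero, ← two_mul] at this
        exact (mul_eq_zero.1 this).resolve_left h2
      · exact congrFun hf ⟨(i, i), .inr ⟨rfl, h⟩⟩
    · have := f.2 _ _ (b i) (b j) (hb i) (hb j)
      rw [hlt h] at this
      simpa using this
  have hsurj : Function.Surjective Φ := by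
    intro g
    -- The prescribed values, extended below the diagonal by the sign rule and by zero on the even
    -- diagonal.
    let A (i j : ι) : F := if h : i < j ∨ i = j ∧ π i = 1 then g ⟨(i, j), h⟩ else
      if h : j < i then -((-1 : F) ^ ((π i).val * (π j).val) * g ⟨(j, i), .inl h⟩) else 0
    have hA (i j : ι) : A i j = -((-1 : F) ^ ((π i).val * (π j).val) * A j i) := by
      obtain h | rfl | h := lt_trichotomy i j
      · have e : (-1 : F) ^ ((π i).val * (π j).val) * (-1 : F) ^ ((π i).val * (π j).val) = 1 := by
          rw [← mul_pow]; simp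
        simp only [A, h, true_or, dif_pos, h.not_gt, h.ne', false_and, or_self, dif_neg,
          not_false_eq_true, mul_comm (π j).val]
        linear_combination (-g ⟨(i, j), .inl h⟩) * e
      · obtain h | h := zmod_two_cases (π i)
        · simp [A, h]
        · simp [A, h, ZMod.val_one]
      · simp [A, h, h.not_gt, h.ne']
    let f : L →ₗ[F] L →ₗ[F] F := b.constr F fun i => b.constr F fun j => A i j
    have hf (i j : ι) : f (b i) (b j) = A i j := by simp [f]
    refine ⟨⟨f, mem_superSkew_of_basis b π hb fun i j => by rw [hf, hf, hA]⟩, ?_⟩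
    ext p
    exact (hf _ _).trans (dif_pos p.2)
  rw [(LinearEquiv.ofBijective Φ ⟨hinj, hsurj⟩).finrank_eq, Module.finrank_fintype_fun_eq_card]

lemma finrank_superSkew [FiniteDimensional F L] (h2 : (2 : F) ≠ 0) :
    2 * Module.finrank F (superSkew F L) + Module.finrank F L =
      Module.finrank F L * Module.finrank F L
        + 2 * Module.finrank F (gr (F := F) (L := L) 1) := by
  obtain ⟨b, hb⟩ := exists_gr_basis (F := F) (L := L)
  -- Any linear order on the index set serves, since the count does not depend on it.
  let _ : LinearOrder (Fin (Module.finrank F (gr (F := F) (L := L) 0)) ⊕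
    Fin (Module.finrank F (gr (F := F) (L := L) 1))) :=
    LinearOrder.lift' finSumFinEquiv finSumFinEquiv.injective
  rw [finrank_superSkew_of_basis h2 b _ hb]
  have := card_skewIndex (Sum.elim (fun _ => 0) (fun _ => 1) :
    Fin (Module.finrank F (gr (F := F) (L := L) 0)) ⊕
      Fin (Module.finrank F (gr (F := F) (L := L) 1)) → ZMod 2)
  have hc : Fintype.card {i : Fin (Module.finrank F (gr (F := F) (L := L) 0)) ⊕
      Fin (Module.finrank F (gr (F := F) (L := L) 1)) //
        (Sum.elim (fun _ => 0) (fun _ => 1) i : ZMod 2) = 1} =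
      Module.finrank F (gr (F := F) (L := L) 1) := by
    rw [Fintype.card_subtype, Finset.card_filter, Fintype.sum_sum_type]
    simp
  rwa [hc, Fintype.card_sum, Fintype.card_fin, Fintype.card_fin, finrank_gr_add] at this

end SuperSkew

/-! ### The codimension of the cocycles among the skew forms. -/

section CocycleDimension

set_option maxSynthPendingDepth 3

variable {F : Type*} {L : Type*} [Field F] [AddCommGroup L] [Module F L] [LieSuperalgebra F L]

/-- The graded skew-symmetrization of `φ ⊗ ζ`. -/
noncomputable def skewProd (φ ζ : L →ₗ[F] F) : L →ₗ[F] L →ₗ[F] F :=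
  φ.smulRight ζ - ζ.smulRight φ +
    -- This term turns the minus sign of the second summand into a plus on pairs of odd vectors.
    (2 : F) • (ζ ∘ₗ grProj F L 1).smulRight (φ ∘ₗ grProj F L 1)

lemma skewProd_apply (φ ζ : L →ₗ[F] F) {a b : ZMod 2} {x y : L} (hx : x ∈ gr (F := F) a)
    (hy : y ∈ gr (F := F) b) :
    skewProd φ ζ x y = φ x * ζ y - (-1 : F) ^ (a.val * b.val) * (φ y * ζ x) := by
  have e : skewProd φ ζ x y = φ x * ζ y - ζ x * φ y +
      2 * (ζ (grProj F L 1 x) * φ (grProj F L 1 y)) := rfl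
  rw [e, grProj_of_mem hx, grProj_of_mem hy]
  obtain rfl | rfl := zmod_two_cases a <;> obtain rfl | rfl := zmod_two_cases b <;>
    simp [ZMod.val_one] <;> ring

lemma skewProd_mem (φ ζ : L →ₗ[F] F) : skewProd φ ζ ∈ superSkew F L := by
  intro a b x y hx hy
  rw [skewProd_apply φ ζ hx hy, skewProd_apply φ ζ hy hx, mul_comm b.val]
  have e : (-1 : F) ^ (a.val * b.val) * (-1 : F) ^ (a.val * b.val) = 1 := by
    rw [← mul_pow]; simp
  linear_combination (-φ x * ζ y) * e

/-- Independence of the conditions `f w z = 0`. For even `z` the value `f z z` must vanish, so `φ`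
can be realized only where `ζ` vanishes; for odd `z` there is no obstruction. -/
lemma exists_superSkew_apply_eq (h2 : (2 : F) ≠ 0) {d : ZMod 2} {z : L} (hz : z ∈ gr (F := F) d)
    (ζ : L →ₗ[F] F) (hζ : ∀ (a : ZMod 2) (x : L), x ∈ gr (F := F) a → a ≠ d → ζ x = 0)
    (hζz : ζ z = 1) (φ : L →ₗ[F] F) :
    ∃ f ∈ superSkew F L, ∀ w, (d = 1 ∨ ζ w = 0) → f w z = φ w := by
  obtain rfl | rfl := zmod_two_cases d
  · refine ⟨skewProd (φ - φ z • ζ) ζ, skewProd_mem _ _, fun w hw => ?_⟩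
    have key (w : L) : skewProd (φ - φ z • ζ) ζ w z = (φ - φ z • ζ) w := by
      refine gr_induction F (p := fun w => skewProd _ ζ w z = (φ - φ z • ζ) w) w
        (fun a x hx => ?_) fun x y hx hy => ?_
      · rw [skewProd_apply _ _ hx hz]
        simp [hζz]
      · rw [map_add, LinearMap.add_apply, hx, hy, map_add]
    rw [key]
    simp [hw.resolve_left (by decide)]
  -- Both terms of the symmetrization contribute at odd `w`; removing half of `φ z` makes the `ζ w`
  -- contributions cancel.
  · refine ⟨skewProd (φ - (φ z / 2) • ζ) ζ, skewProd_mem _ _, fun w _ => ?_⟩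
    refine gr_induction F (p := fun w => skewProd _ ζ w z = φ w) w
      (fun a x hx => ?_) fun x y hx hy => ?_
    · rw [skewProd_apply _ _ hx hz]
      obtain rfl | rfl := zmod_two_cases a
      · simp [hζz, hζ 0 x hx]
      · simp [hζz, ZMod.val_one]
        field_simp
        ring
    · rw [map_add, LinearMap.add_apply, hx, hy, map_add]

/-- Rank–nullity for the map sending `f` to the restriction of `f · z` to `K`: it is onto the dual
of `K`, and its kernel is the space of cocycles. -/
lemma finrank_cocycles_add [FiniteDimensional F L] (h2 : (2 : F) ≠ 0) {d : ZMod 2} {z : L}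
    (hz : z ∈ gr (F := F) d) (ζ : L →ₗ[F] F)
    (hζ : ∀ (a : ZMod 2) (x : L), x ∈ gr (F := F) a → a ≠ d → ζ x = 0) (hζz : ζ z = 1)
    (K : Submodule F L) (hK : ∀ w ∈ K, d = 1 ∨ ζ w = 0)
    (hf : ∀ f ∈ superSkew F L, f ∈ cocycles F L ↔ ∀ w ∈ K, f w z = 0) :
    Module.finrank F (cocycles F L) + Module.finrank F K =
      Module.finrank F (superSkew F L) := by
  let T : superSkew F L →ₗ[F] Module.Dual F K :=
    { toFun := fun f => (f.1.flip z) ∘ₗ K.subtype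
      map_add' := fun _ _ => rfl
      map_smul' := fun _ _ => rfl }
  have hsurj : LinearMap.range T = ⊤ := by
    refine LinearMap.range_eq_top.2 fun φ => ?_
    obtain ⟨φ', rfl⟩ := LinearMap.exists_extend φ
    obtain ⟨f, hf, h⟩ := exists_superSkew_apply_eq h2 hz ζ hζ hζz φ'
    exact ⟨⟨f, hf⟩, LinearMap.ext fun w => h _ (hK _ w.2)⟩
  have hker : (LinearMap.ker T).map (superSkew F L).subtype = cocycles F L := by
    ext f
    constructor
    · rintro ⟨g, hg, rfl⟩
      exact (hf _ g.2).2 fun w hw => LinearMap.congr_fun hg ⟨w, hw⟩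
    · intro h
      exact ⟨⟨f, h.1⟩, LinearMap.ext fun w => (hf f h.1).1 h _ w.2, rfl⟩
  have := T.finrank_range_add_finrank_ker
  rw [hsurj, finrank_top, Subspace.dual_finrank_eq] at this
  rw [← hker, Submodule.finrank_map_subtype_eq]
  omega

end CocycleDimension

/-! ### The cocycle identity when all brackets lie on one line. -/

section CocycleConditions

variable {F : Type*} {L : Type*} [Field F] [AddCommGroup L] [Module F L] [LieSuperalgebra F L]

/-- If all brackets lie in the line through `z`, a cocycle that vanishes against `z` on a
homogeneous pair with bracket `z` vanishes against `z` everywhere. -/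
lemma cocycle_apply_eq_zero_of_pair {f : L →ₗ[F] L →ₗ[F] F} (hf : f ∈ cocycles F L) {z : L}
    {a b c : ZMod 2} {x y w : L} (hx : x ∈ gr (F := F) a) (hy : y ∈ gr (F := F) b)
    (hw : w ∈ gr (F := F) c) (hxy : br (F := F) x y = z) {r s : F}
    (hyw : br (F := F) y w = r • z) (hwx : br (F := F) w x = s • z)
    (h1 : r * f x z = 0) (h2 : s * f y z = 0) : f w z = 0 := by
  have := hf.2 a b c x y w hx hy hw
  rw [hyw, hwx, hxy, map_smul, map_smul, smul_eq_mul, smul_eq_mul, h1, h2, mul_zero, mul_zero,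
    zero_add, zero_add] at this
  exact (mul_eq_zero.1 this).resolve_left (pow_ne_zero _ (neg_ne_zero.2 one_ne_zero))

lemma cocycle_apply_eq_zero_of_forall_pair {f : L →ₗ[F] L →ₗ[F] F} (hf : f ∈ cocycles F L) {z : L}
    (hL : ∀ u v : L, ∃ c : F, br (F := F) u v = c • z)
    {a b : ZMod 2} {x y : L} (hx : x ∈ gr (F := F) a) (hy : y ∈ gr (F := F) b)
    (hxy : br (F := F) x y = z) (h1 : f x z = 0) (h2 : f y z = 0) (w : L) : f w z = 0 := by
  refine gr_induction F (p := fun w => f w z = 0) w (fun c w hw => ?_) fun u v hu hv => ?_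
  · obtain ⟨r, hr⟩ := hL y w
    obtain ⟨s, hs⟩ := hL w x
    exact cocycle_apply_eq_zero_of_pair hf hx hy hw hxy hr hs (by simp [h1]) (by simp [h2])
  · rw [map_add, LinearMap.add_apply, hu, hv, add_zero]

/-- The cocycle identity on `(x', y', x)` and on `(x', y', y)` retains only the term against `z`, by
orthogonality. Hence `f x z = f y z = 0`, and the pair `(x, y)` then handles every other vector. -/
lemma cocycle_apply_eq_zero_of_two_pairs {f : L →ₗ[F] L →ₗ[F] F} (hf : f ∈ cocycles F L) {z : L}
    (hL : ∀ u v : L, ∃ c : F, br (F := F) u v = c • z)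
    {a b c d : ZMod 2} {x y x' y' : L} (hx : x ∈ gr (F := F) a) (hy : y ∈ gr (F := F) b)
    (hx' : x' ∈ gr (F := F) c) (hy' : y' ∈ gr (F := F) d)
    (hxy : br (F := F) x y = z) (hxy' : br (F := F) x' y' = z)
    (h1 : br (F := F) x x' = 0) (h2 : br (F := F) y x' = 0)
    (h3 : br (F := F) y' x = 0) (h4 : br (F := F) y' y = 0) (w : L) : f w z = 0 :=
  cocycle_apply_eq_zero_of_forall_pair hf hL hx hy hxy
    (cocycle_apply_eq_zero_of_pair hf hx' hy' hx hxy' (r := 0) (s := 0) (by simp [h3])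
      (by simp [h1]) (zero_mul _) (zero_mul _))
    (cocycle_apply_eq_zero_of_pair hf hx' hy' hy hxy' (r := 0) (s := 0) (by simp [h4])
      (by simp [h2]) (zero_mul _) (zero_mul _)) w

lemma mem_cocycles_of_forall_apply_eq_zero {f : L →ₗ[F] L →ₗ[F] F} (hf : f ∈ superSkew F L) {z : L}
    (hL : ∀ u v : L, ∃ c : F, br (F := F) u v = c • z) (hz : ∀ w, f w z = 0) :
    f ∈ cocycles F L := by
  have h (u v w : L) : f u (br (F := F) v w) = 0 := by
    obtain ⟨c, hc⟩ := hL v w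
    rw [hc, map_smul, hz, smul_zero]
  exact ⟨hf, fun a b c x y z _ _ _ => by simp [h]⟩

lemma derived_eq_span {z : L} (hL : ∀ u v : L, ∃ c : F, br (F := F) u v = c • z)
    {x y : L} (hxy : br (F := F) x y = z) : derived F L = Submodule.span F {z} := by
  refine le_antisymm (Submodule.map₂_le.2 fun u _ v _ => ?_) ?_
  · obtain ⟨c, hc⟩ := hL u v
    rw [hc]
    exact Submodule.smul_mem _ _ (Submodule.mem_span_singleton_self z)
  · rw [Submodule.span_singleton_le_iff_mem, ← hxy]
    exact Submodule.apply_mem_map₂ _ trivial trivial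

end CocycleConditions

/-! ### The central extension attached to a cocycle. -/

section CentralExtension

variable {F : Type*} {L : Type*} [Field F] [AddCommGroup L] [Module F L] [LieSuperalgebra F L]

/-- The component of degree `d` of a bilinear form. -/
noncomputable def degPart (f : L →ₗ[F] L →ₗ[F] F) (d : ZMod 2) : L →ₗ[F] L →ₗ[F] F :=
  f.compl₁₂ (grProj F L 0) (grProj F L d) + f.compl₁₂ (grProj F L 1) (grProj F L (d + 1))

lemma degPart_apply (f : L →ₗ[F] L →ₗ[F] F) (d : ZMod 2) {a b : ZMod 2} {x y : L}
    (hx : x ∈ gr (F := F) a) (hy : y ∈ gr (F := F) b) :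
    degPart f d x y = if a + b = d then f x y else 0 := by
  simp only [degPart, LinearMap.add_apply, LinearMap.compl₁₂_apply, grProj_of_mem hx,
    grProj_of_mem hy]
  obtain rfl | rfl := zmod_two_cases a <;> obtain rfl | rfl := zmod_two_cases b <;>
    obtain rfl | rfl := zmod_two_cases d <;> simp [show (1 : ZMod 2) + 1 = 0 from rfl]

lemma degPart_add (f : L →ₗ[F] L →ₗ[F] F) (x y : L) :
    degPart f 0 x y + degPart f 1 x y = f x y := by
  conv_rhs => rw [← grProj_add (F := F) x, ← grProj_add (F := F) y]
  simp only [degPart, LinearMap.add_apply, LinearMap.compl₁₂_apply, map_add, zero_add,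
    show (1 : ZMod 2) + 1 = 0 from rfl]
  ring

/-- The three terms of the cocycle identity have the same total degree, so on each homogeneous
triple the identity for the part either is the one for `f` or reads `0 = 0`. -/
lemma degPart_mem_cocycles {f : L →ₗ[F] L →ₗ[F] F} (hf : f ∈ cocycles F L) (d : ZMod 2) :
    degPart f d ∈ cocycles F L := by
  refine ⟨fun a b x y hx hy => ?_, fun a b c x y z hx hy hz => ?_⟩
  · rw [degPart_apply f d hx hy, degPart_apply f d hy hx, add_comm b a]
    split_ifs
    · exact hf.1 a b x y hx hy
    · simp
  · rw [degPart_apply f d hx (br_mem _ _ _ _ hy hz), degPart_apply f d hy (br_mem _ _ _ _ hz hx),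
      degPart_apply f d hz (br_mem _ _ _ _ hx hy), show b + (c + a) = a + (b + c) by ring,
      show c + (a + b) = a + (b + c) by ring]
    split_ifs
    · exact hf.2 a b c x y z hx hy hz
    · simp

/-- The central extension of `L` by `F ⊕ F` (one even and one odd dimension) defined by the
homogeneous components of a cocycle. -/
def CentralExtension (_ : cocycles F L) : Type _ := L × (F × F)

variable (f : cocycles F L)

instance : AddCommGroup (CentralExtension f) := inferInstanceAs (AddCommGroup (L × (F × F)))

instance : Module F (CentralExtension f) := inferInstanceAs (Module F (L × (F × F)))

/-- The bracket of the central extension. -/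
noncomputable def centralExtensionBr : L × (F × F) →ₗ[F] L × (F × F) →ₗ[F] L × (F × F) :=
  LinearMap.mk₂ F
    (fun x y => (br (F := F) x.1 y.1, (degPart f.1 0 x.1 y.1, degPart f.1 1 x.1 y.1)))
    (by intros; simp) (by intros; simp) (by intros; simp) (by intros; simp)

lemma centralExtensionBr_apply (x y : L × (F × F)) : centralExtensionBr f x y =
    (br (F := F) x.1 y.1, (degPart f.1 0 x.1 y.1, degPart f.1 1 x.1 y.1)) := rfl

/-- The Lie superalgebra structure of the central extension. -/
noncomputable abbrev centralExtensionStruct : LieSuperalgebra F (L × (F × F)) where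
  gr a := (gr a).prod (stdGr F F F a)
  isCompl_gr := by
    have hL := isCompl_gr (F := F) (L := L)
    have hM : IsCompl (stdGr F F F 0) (stdGr F F F 1) := isCompl_prod_fst_snd F F F
    rw [isCompl_iff, disjoint_iff, codisjoint_iff] at *
    refine ⟨?_, ?_⟩
    · rw [Submodule.prod_inf_prod, hL.1, hM.1, Submodule.prod_bot]
    · rw [Submodule.prod_sup_prod, hL.2, hM.2, Submodule.prod_top]
  br := centralExtensionBr f
  br_mem a b x y hx hy := by
    refine ⟨br_mem a b _ _ hx.1 hy.1, ?_⟩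
    simp only [centralExtensionBr_apply, degPart_apply f.1 _ hx.1 hy.1]
    obtain h | h := zmod_two_cases (a + b) <;> rw [h]
    · exact (mem_stdGr_zero F _).2 rfl
    · exact (mem_stdGr_one F _).2 rfl
  br_skew a b x y hx hy := by
    simp only [centralExtensionBr_apply, Prod.smul_mk, Prod.neg_mk, smul_eq_mul]
    rw [← br_skew a b _ _ hx.1 hy.1,
      ← (degPart_mem_cocycles f.2 0).1 a b _ _ hx.1 hy.1,
      ← (degPart_mem_cocycles f.2 1).1 a b _ _ hx.1 hy.1]
  br_jacobi a b c x y z hx hy hz := by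
    simp only [centralExtensionBr_apply, Prod.smul_mk, Prod.mk_add_mk, smul_eq_mul]
    rw [br_jacobi a b c _ _ _ hx.1 hy.1 hz.1,
      (degPart_mem_cocycles f.2 0).2 a b c _ _ _ hx.1 hy.1 hz.1,
      (degPart_mem_cocycles f.2 1).2 a b c _ _ _ hx.1 hy.1 hz.1]
    rfl

noncomputable instance : LieSuperalgebra F (CentralExtension f) := centralExtensionStruct f

/-- The projection of the central extension onto `L`. -/
def CentralExtension.fst : Hom F (CentralExtension f) L where
  toLinearMap := LinearMap.fst F L (F × F)
  map_gr _ _ hx := hx.1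
  map_br _ _ := rfl

/-- The sum of the two central coordinates. -/
def CentralExtension.coord : CentralExtension f →ₗ[F] F :=
  (LinearMap.fst F F F + LinearMap.snd F F F) ∘ₗ LinearMap.snd F L (F × F)

/-- Splitting `f` by degree keeps the extension graded; adding the two central coordinates, an
operation that ignores the grading, puts `f` together again. -/
lemma CentralExtension.coord_br (x y : CentralExtension f) :
    CentralExtension.coord f (br (F := F) x y) =
      f.1 ((CentralExtension.fst f).toLinearMap x) ((CentralExtension.fst f).toLinearMap y) :=
  degPart_add f.1 _ _

end CentralExtension

/-! ### Homomorphisms, gradings and free superalgebras. -/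

section FreeHom

variable {F : Type*} [Field F] {X₀ X₁ : Type*}
  {L : Type*} [AddCommGroup L] [Module F L] [LieSuperalgebra F L]
  {M : Type*} [AddCommGroup M] [Module F M] [LieSuperalgebra F M]

lemma hom_br (g : Hom F L M) (x y : L) :
    g.toLinearMap (br (F := F) x y) = br (F := F) (g.toLinearMap x) (g.toLinearMap y) :=
  g.map_br x y

lemma hom_mem_gr (g : Hom F L M) {a : ZMod 2} {x : L} (hx : x ∈ gr (F := F) a) :
    g.toLinearMap x ∈ gr (F := F) (L := M) a :=
  g.map_gr a x hx

lemma hom_grProj (g : Hom F L M) (a : ZMod 2) (x : L) :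
    g.toLinearMap (grProj F L a x) = grProj F M a (g.toLinearMap x) := by
  refine gr_induction F
    (p := fun x => g.toLinearMap (grProj F L a x) = grProj F M a (g.toLinearMap x)) x
    (fun b x hx => ?_) fun x y hx hy => ?_
  · rw [grProj_of_mem hx, grProj_of_mem (hom_mem_gr g hx)]
    split_ifs <;> simp
  · simp only [map_add, hx, hy]

/-- Homomorphisms out of a free Lie superalgebra are determined by the images of the
generators. -/
lemma free_hom_ext {g h : FreeLieSuperalgebra F X₀ X₁ →ₗ[F] L}
    (hg : ∀ x y, g (br (F := F) x y) = br (F := F) (g x) (g y))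
    (hh : ∀ x y, h (br (F := F) x y) = br (F := F) (h x) (h y))
    (hgen : ∀ x, g (freeMk F (.of F x)) = h (freeMk F (.of F x))) : g = h := by
  have hmon (w : FreeMagma (X₀ ⊕ X₁)) : g (freeMk F (MonoidAlgebra.single w 1)) =
      h (freeMk F (MonoidAlgebra.single w 1)) := by
    induction w with
    | ih1 x => exact hgen x
    | ih2 u v hu hv =>
      have e : freeMk F (MonoidAlgebra.single (u * v) (1 : F)) =
          br (F := F) (freeMk F (MonoidAlgebra.single u (1 : F)))
            (freeMk F (MonoidAlgebra.single v (1 : F))) := by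
        refine Eq.trans ?_ (freeBr_mk F _ _).symm
        rw [MonoidAlgebra.single_mul_single, one_mul]
      rw [e, hg, hh, hu, hv]
  refine LinearMap.ext fun x => ?_
  obtain ⟨x, rfl⟩ := freeMk_surjective F x
  rw [← MonoidAlgebra.sum_coeff_single x, Finsupp.sum]
  simp only [map_sum]
  refine Finset.sum_congr rfl fun w _ => ?_
  rw [← mul_one (x.coeff w), ← smul_eq_mul, ← MonoidAlgebra.smul_single]
  simp only [map_smul, hmon]

end FreeHom

/-! ### The multiplier of a free presentation in terms of cocycles. -/

namespace FreePresentation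

set_option maxSynthPendingDepth 3

universe w

variable {F : Type*} {L : Type*} [Field F] [AddCommGroup L] [Module F L] [LieSuperalgebra F L]
  (P : FreePresentation.{w} F L)

/-- `[𝓕, R]`. -/
noncomputable def bracketR : Submodule F (FreeLieSuperalgebra F P.X₀ P.X₁) := bracket F ⊤ P.R

lemma br_mem_bracketR_right {r : FreeLieSuperalgebra F P.X₀ P.X₁} (hr : r ∈ P.R)
    (u : FreeLieSuperalgebra F P.X₀ P.X₁) : br (F := F) u r ∈ P.bracketR :=
  Submodule.apply_mem_map₂ _ trivial hr

/-- `R` is the kernel of an even map, hence contains the homogeneous components of its elements;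
graded skew-symmetry then exchanges the two sides. -/
lemma br_mem_bracketR_left {r : FreeLieSuperalgebra F P.X₀ P.X₁} (hr : r ∈ P.R)
    (u : FreeLieSuperalgebra F P.X₀ P.X₁) : br (F := F) r u ∈ P.bracketR := by
  have hproj (a : ZMod 2) : grProj F _ a r ∈ P.R := by
    have : P.ψ.toLinearMap r = 0 := hr
    exact LinearMap.mem_ker.2 (by rw [hom_grProj, this, map_zero])
  refine gr_induction F (p := fun u => br (F := F) r u ∈ P.bracketR) u (fun b u hu => ?_)
    fun x y hx hy => by simpa only [map_add] using add_mem hx hy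
  have h (a : ZMod 2) : br (F := F) (grProj F _ a r) u ∈ P.bracketR := by
    rw [br_skew a b _ _ (grProj_mem a r) hu]
    exact neg_mem (Submodule.smul_mem _ _ (P.br_mem_bracketR_right (hproj a) u))
  rw [← grProj_add (F := F) r, map_add, LinearMap.add_apply]
  exact add_mem (h 0) (h 1)

/-- The map `L × L → 𝓕 / [𝓕, R]` induced by the bracket of `𝓕`. -/
noncomputable def liftBr :
    L →ₗ[F] L →ₗ[F] FreeLieSuperalgebra F P.X₀ P.X₁ ⧸ P.bracketR :=
  let σ := (P.ψ.toLinearMap.exists_rightInverse_of_surjective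
    (LinearMap.range_eq_top.2 P.surjective)).choose
  ((br (F := F)).compl₁₂ σ σ).compr₂ P.bracketR.mkQ

/-- Changing lifts alters a bracket by an element of `[R, 𝓕] + [𝓕, R]`, so the chosen section does
not matter. -/
lemma liftBr_apply (u v : FreeLieSuperalgebra F P.X₀ P.X₁) :
    P.liftBr (P.ψ.toLinearMap u) (P.ψ.toLinearMap v) = P.bracketR.mkQ (br (F := F) u v) := by
  let σ := (P.ψ.toLinearMap.exists_rightInverse_of_surjective
    (LinearMap.range_eq_top.2 P.surjective)).choose
  have hσ (x : L) : P.ψ.toLinearMap (σ x) = x := LinearMap.congr_fun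
    (P.ψ.toLinearMap.exists_rightInverse_of_surjective
      (LinearMap.range_eq_top.2 P.surjective)).choose_spec x
  change P.bracketR.mkQ (br (F := F) (σ _) (σ _)) = _
  have hR (u) : σ (P.ψ.toLinearMap u) - u ∈ P.R :=
    LinearMap.mem_ker.2 (by rw [map_sub, hσ, sub_self])
  rw [← sub_eq_zero, ← map_sub, Submodule.mkQ_apply, Submodule.Quotient.mk_eq_zero]
  have := add_mem (P.br_mem_bracketR_left (hR u) (σ (P.ψ.toLinearMap v)))
    (P.br_mem_bracketR_right (hR v) u)
  simpa only [map_sub, LinearMap.sub_apply, sub_add_sub_cancel] using this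

/-- The image of `[𝓕, 𝓕]` in `𝓕 / [𝓕, R]`. -/
noncomputable def derivedQuot : Submodule F (FreeLieSuperalgebra F P.X₀ P.X₁ ⧸ P.bracketR) :=
  (derived F (FreeLieSuperalgebra F P.X₀ P.X₁)).map P.bracketR.mkQ

lemma derivedQuot_eq : P.derivedQuot = Submodule.map₂ P.liftBr ⊤ ⊤ := by
  refine le_antisymm ?_ (Submodule.map₂_le.2 fun x _ y _ => ?_)
  · rw [derivedQuot, Submodule.map_le_iff_le_comap]
    refine Submodule.map₂_le.2 fun u _ v _ => ?_
    rw [Submodule.mem_comap, ← liftBr_apply]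
    exact Submodule.apply_mem_map₂ _ trivial trivial
  · obtain ⟨u, rfl⟩ := P.surjective x
    obtain ⟨v, rfl⟩ := P.surjective y
    rw [liftBr_apply]
    exact Submodule.mem_map_of_mem (Submodule.apply_mem_map₂ _ trivial trivial)

/-- Although `𝓕` may be infinite-dimensional, brackets modulo `[𝓕, R]` depend only on the images of
their arguments in `L`, so finitely many of them span. -/
instance [FiniteDimensional F L] : FiniteDimensional F P.derivedQuot := by
  rw [derivedQuot_eq]
  exact Module.Finite.iff_fg.2 (Submodule.FG.map₂ _ Module.Finite.fg_top Module.Finite.fg_top)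

lemma exists_mem_gr {a : ZMod 2} {x : L} (hx : x ∈ gr (F := F) a) :
    ∃ u ∈ gr (F := F) (L := FreeLieSuperalgebra F P.X₀ P.X₁) a, P.ψ.toLinearMap u = x := by
  obtain ⟨u, rfl⟩ := P.surjective x
  exact ⟨grProj F _ a u, grProj_mem a u, by rw [hom_grProj, grProj_self hx]⟩

lemma liftBr_compr₂_mem_cocycles
    (φ : FreeLieSuperalgebra F P.X₀ P.X₁ ⧸ P.bracketR →ₗ[F] F) :
    P.liftBr.compr₂ φ ∈ cocycles F L := by
  refine ⟨fun a b x y hx hy => ?_, fun a b c x y z hx hy hz => ?_⟩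
  · obtain ⟨u, hu, rfl⟩ := P.exists_mem_gr hx
    obtain ⟨v, hv, rfl⟩ := P.exists_mem_gr hy
    simp only [LinearMap.compr₂_apply, liftBr_apply]
    rw [br_skew a b u v hu hv, map_neg, map_neg, map_smul, map_smul, smul_eq_mul]
  · obtain ⟨u, hu, rfl⟩ := P.exists_mem_gr hx
    obtain ⟨v, hv, rfl⟩ := P.exists_mem_gr hy
    obtain ⟨t, ht, rfl⟩ := P.exists_mem_gr hz
    have h := congrArg (φ ∘ₗ P.bracketR.mkQ) (br_jacobi a b c u v t hu hv ht)
    simp only [map_add, map_smul, map_zero, smul_eq_mul, LinearMap.comp_apply] at h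
    simpa only [LinearMap.compr₂_apply, ← hom_br, liftBr_apply] using h

/-- Here freeness enters: `ψ` lifts to the central extension defined by `f`. The central coordinate
`Λ` of the lift satisfies `Λ [u, v] = f (ψ u) (ψ v)`, so it vanishes on `[𝓕, R]` and descends to the
quotient. -/
lemma exists_liftBr_compr₂_eq {f : L →ₗ[F] L →ₗ[F] F} (hf : f ∈ cocycles F L) :
    ∃ φ : FreeLieSuperalgebra F P.X₀ P.X₁ ⧸ P.bracketR →ₗ[F] F, P.liftBr.compr₂ φ = f := by
  let g₀ (x : P.X₀) : gr (F := F) (L := CentralExtension ⟨f, hf⟩) 0 :=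
    ⟨((P.ψ.toLinearMap (freeMk F (.of F (.inl x))), 0) : L × (F × F)),
      hom_mem_gr P.ψ ⟨_, Submodule.subset_span ⟨.of (.inl x), rfl, rfl⟩, rfl⟩,
      Submodule.zero_mem _⟩
  let g₁ (x : P.X₁) : gr (F := F) (L := CentralExtension ⟨f, hf⟩) 1 :=
    ⟨((P.ψ.toLinearMap (freeMk F (.of F (.inr x))), 0) : L × (F × F)),
      hom_mem_gr P.ψ ⟨_, Submodule.subset_span ⟨.of (.inr x), rfl, rfl⟩, rfl⟩,
      Submodule.zero_mem _⟩
  have hfst : (CentralExtension.fst ⟨f, hf⟩).toLinearMap ∘ₗ (lift g₀ g₁).toLinearMap =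
      P.ψ.toLinearMap := by
    refine free_hom_ext (fun x y => ?_) (hom_br P.ψ) ?_
    · simp only [LinearMap.comp_apply, hom_br]
    · rintro (x | x)
      · rw [LinearMap.comp_apply, lift_inl]; rfl
      · rw [LinearMap.comp_apply, lift_inr]; rfl
  let Λ := CentralExtension.coord ⟨f, hf⟩ ∘ₗ (lift g₀ g₁).toLinearMap
  have hΛ (u v) : Λ (br (F := F) u v) = f (P.ψ.toLinearMap u) (P.ψ.toLinearMap v) := by
    rw [← hfst]
    simp only [Λ, LinearMap.comp_apply, hom_br, CentralExtension.coord_br]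
  refine ⟨P.bracketR.liftQ Λ (Submodule.map₂_le.2 fun u _ r hr => ?_), ?_⟩
  · have : P.ψ.toLinearMap r = 0 := hr
    rw [LinearMap.mem_ker, hΛ, this, map_zero]
  · refine LinearMap.ext₂ fun x y => ?_
    obtain ⟨u, rfl⟩ := P.surjective x
    obtain ⟨v, rfl⟩ := P.surjective y
    rw [LinearMap.compr₂_apply, liftBr_apply]
    exact hΛ u v

/-- Composing functionals with `liftBr` maps onto the cocycles, and the kernel is the annihilator of
the image of `[𝓕, 𝓕]`; the quotient by an annihilator is the dual of the subspace. -/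
lemma finrank_cocycles_eq :
    Module.finrank F (cocycles F L) = Module.finrank F (Module.Dual F P.derivedQuot) := by
  let Θ : Module.Dual F (FreeLieSuperalgebra F P.X₀ P.X₁ ⧸ P.bracketR) →ₗ[F]
      L →ₗ[F] L →ₗ[F] F :=
    { toFun := fun φ => P.liftBr.compr₂ φ
      map_add' := fun _ _ => rfl
      map_smul' := fun _ _ => rfl }
  have hrange : LinearMap.range Θ = cocycles F L := by
    refine le_antisymm ?_ fun f hf => P.exists_liftBr_compr₂_eq hf
    rintro _ ⟨φ, rfl⟩
    exact P.liftBr_compr₂_mem_cocycles φ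
  have hker : LinearMap.ker Θ = P.derivedQuot.dualAnnihilator := by
    ext φ
    rw [Submodule.mem_dualAnnihilator, derivedQuot_eq]
    constructor
    · intro h x hx
      have : Submodule.map₂ P.liftBr ⊤ ⊤ ≤ LinearMap.ker φ :=
        Submodule.map₂_le.2 fun x _ y _ => LinearMap.congr_fun₂ h x y
      exact this hx
    · exact fun h => LinearMap.ext₂ fun x y =>
        h _ (Submodule.apply_mem_map₂ _ trivial trivial)
  rw [← hrange, ← Θ.quotKerEquivRange.finrank_eq, hker,
    (Subspace.quotAnnihilatorEquiv P.derivedQuot).finrank_eq]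

/-- The multiplier as a subspace of `𝓕 / [𝓕, R]`. -/
noncomputable def multiplierEquiv :
    P.Multiplier ≃ₗ[F] P.derivedInfR.map P.bracketR.mkQ :=
  (Submodule.quotEquivOfEq _ _ (by
    rw [LinearMap.ker_comp, Submodule.ker_mkQ]; rfl)).trans
    ((P.bracketR.mkQ ∘ₗ P.derivedInfR.subtype).quotKerEquivRange.trans
      (LinearEquiv.ofEq _ _ (by rw [LinearMap.range_comp, Submodule.range_subtype])))

/-- The map induced by `ψ` sends `[𝓕, 𝓕] / [𝓕, R]` onto `L'`, and its kernel is the multiplier. -/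
lemma finrank_multiplier_add [FiniteDimensional F L] :
    FiniteDimensional F P.Multiplier ∧
      Module.finrank F P.Multiplier + Module.finrank F (derived F L) =
        Module.finrank F (cocycles F L) := by
  have hle : P.derivedInfR.map P.bracketR.mkQ ≤ P.derivedQuot :=
    Submodule.map_mono inf_le_left
  have hfin : FiniteDimensional F (P.derivedInfR.map P.bracketR.mkQ) :=
    Submodule.finiteDimensional_of_le hle
  refine ⟨Module.Finite.equiv P.multiplierEquiv.symm, ?_⟩
  let ψ' := P.bracketR.liftQ P.ψ.toLinearMap (Submodule.map₂_le.2 fun u _ r hr => by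
    have : P.ψ.toLinearMap r = 0 := hr
    rw [LinearMap.mem_ker, hom_br, this, map_zero])
  have hψ' (u) : ψ' (P.bracketR.mkQ u) = P.ψ.toLinearMap u := rfl
  have hrange : LinearMap.range (ψ' ∘ₗ P.derivedQuot.subtype) = derived F L := by
    rw [LinearMap.range_comp, Submodule.range_subtype, derivedQuot, ← Submodule.map_comp]
    refine le_antisymm (Submodule.map_le_iff_le_comap.2 (Submodule.map₂_le.2 fun u _ v _ => ?_))
      (Submodule.map₂_le.2 fun x _ y _ => ?_)
    · rw [Submodule.mem_comap, LinearMap.comp_apply, hψ', hom_br]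
      exact Submodule.apply_mem_map₂ _ trivial trivial
    · obtain ⟨u, rfl⟩ := P.surjective x
      obtain ⟨v, rfl⟩ := P.surjective y
      rw [← hom_br]
      exact Submodule.mem_map_of_mem (f := ψ' ∘ₗ P.bracketR.mkQ)
        (Submodule.apply_mem_map₂ _ trivial trivial)
  have hker : (LinearMap.ker (ψ' ∘ₗ P.derivedQuot.subtype)).map P.derivedQuot.subtype =
      P.derivedInfR.map P.bracketR.mkQ := by
    ext x
    constructor
    · rintro ⟨⟨_, u, hu, rfl⟩, hx, rfl⟩
      exact ⟨u, ⟨hu, hx⟩, rfl⟩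
    · rintro ⟨u, ⟨hu, hr⟩, rfl⟩
      exact ⟨⟨_, u, hu, rfl⟩, hr, rfl⟩
  have h := (ψ' ∘ₗ P.derivedQuot.subtype).finrank_range_add_finrank_ker
  rw [hrange, ← Submodule.finrank_map_subtype_eq, hker, ← P.multiplierEquiv.finrank_eq] at h
  rw [finrank_cocycles_eq, Subspace.dual_finrank_eq, ← h, add_comm]

end FreePresentation

/-! ### The invariant `s` when the derived subalgebra is a line. -/

section Invariant

universe w

variable {F : Type*} {L : Type*} [Field F] [AddCommGroup L] [Module F L] [LieSuperalgebra F L]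
  [FiniteDimensional F L]

lemma exists_homogeneous_dual {d : ZMod 2} {z : L} (hz : z ∈ gr (F := F) d) (hz0 : z ≠ 0) :
    ∃ ζ : L →ₗ[F] F, (∀ (a : ZMod 2) (x : L), x ∈ gr (F := F) a → a ≠ d → ζ x = 0) ∧ ζ z = 1 := by
  obtain ⟨φ, hφ⟩ : ∃ φ : Module.Dual F L, φ z ≠ 0 := by
    by_contra! h
    exact hz0 ((Module.forall_dual_apply_eq_zero_iff F z).1 h)
  refine ⟨(φ z)⁻¹ • φ ∘ₗ grProj F L d, fun a x hx had => ?_, ?_⟩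
  · rw [LinearMap.smul_apply, LinearMap.comp_apply, grProj_of_mem hx, if_neg had, map_zero,
      smul_zero]
  · rw [LinearMap.smul_apply, LinearMap.comp_apply, grProj_self hz, smul_eq_mul,
      inv_mul_cancel₀ hφ]

/-- The invariant `s` of a Lie superalgebra with one-dimensional derived subalgebra, in terms of
the vanishing conditions that cut out the cocycles. -/
lemma multiplier_of_derived_eq_span (h2 : (2 : F) ≠ 0) {d : ZMod 2} {z : L}
    (hz : z ∈ gr (F := F) d) (hz0 : z ≠ 0) (hder : derived F L = Submodule.span F {z})
    {ζ : L →ₗ[F] F} (hζ : ∀ (a : ZMod 2) (x : L), x ∈ gr (F := F) a → a ≠ d → ζ x = 0)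
    (hζz : ζ z = 1) {K : Submodule F L} (hK : ∀ w ∈ K, d = 1 ∨ ζ w = 0)
    (hf : ∀ f ∈ superSkew F L, f ∈ cocycles F L ↔ ∀ w ∈ K, f w z = 0)
    (P : FreePresentation.{w} F L) : FiniteDimensional F P.Multiplier ∧
      P.s = Module.finrank F K - Module.finrank F L + 3 := by
  obtain ⟨hfin, h1⟩ := P.finrank_multiplier_add
  refine ⟨hfin, ?_⟩
  have h5 := finrank_cocycles_add h2 hz ζ hζ hζz K hK hf
  have h3 := finrank_superSkew (L := L) h2
  have h4 := finrank_gr_add (F := F) (L := L)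
  rw [hder, finrank_span_singleton hz0] at h1
  rw [FreePresentation.s]
  generalize Module.finrank F P.Multiplier = M at *
  generalize Module.finrank F (cocycles F L) = Z at *
  generalize Module.finrank F (superSkew F L) = S at *
  generalize Module.finrank F K = k at *
  generalize Module.finrank F L = N at *
  generalize Module.finrank F (gr (F := F) (L := L) 0) = m at *
  generalize Module.finrank F (gr (F := F) (L := L) 1) = n at *
  have h1 : (M : ℚ) + 1 = Z := by exact_mod_cast h1
  have h5 : (Z : ℚ) + k = S := by exact_mod_cast h5
  have h3 : 2 * (S : ℚ) + N = N * N + 2 * n := by exact_mod_cast h3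
  have h4 : (m : ℚ) + n = N := by exact_mod_cast h4
  rw [h4]
  linear_combination (-1 : ℚ) * h1 - h5 - h3 / 2

/-- For even `z` skew-symmetry already gives `f z z = 0`, so the conditions live on the hyperplane
`ker ζ`, which complements the line of `z`. -/
lemma multiplier_of_even (h2 : (2 : F) ≠ 0) {z : L} (hz : z ∈ gr (F := F) 0) (hz0 : z ≠ 0)
    (hL : ∀ u v : L, ∃ c : F, br (F := F) u v = c • z) {x y : L} (hxy : br (F := F) x y = z)
    (hf : ∀ f ∈ cocycles F L, ∀ w, f w z = 0)
    (P : FreePresentation.{w} F L) : FiniteDimensional F P.Multiplier ∧ P.s = 2 := by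
  obtain ⟨ζ, hζ, hζz⟩ := exists_homogeneous_dual hz hz0
  have hK : ∀ f ∈ superSkew F L, f ∈ cocycles F L ↔ ∀ w ∈ LinearMap.ker ζ, f w z = 0 := by
    refine fun f hfs => ⟨fun h w _ => hf f h w, fun h => ?_⟩
    refine mem_cocycles_of_forall_apply_eq_zero hfs hL fun w => ?_
    have hzz : f z z = 0 := by
      have := hfs 0 0 z z hz hz
      simp only [ZMod.val_zero, mul_zero, pow_zero, one_mul] at this
      rw [eq_neg_iff_add_eq_zero, ← two_mul] at this
      exact (mul_eq_zero.1 this).resolve_left h2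
    have := h (w - ζ w • z) (by simp [hζz])
    simpa [hzz] using this
  obtain ⟨hfin, hs⟩ := multiplier_of_derived_eq_span h2 hz hz0 (derived_eq_span hL hxy) hζ hζz
    (fun w hw => .inr hw) hK P
  refine ⟨hfin, ?_⟩
  rw [hs, ← finrank_ker_add_one hζz]
  push_cast
  ring

/-- Forms are symmetric on the odd part, so `f z z = 0` is a further independent condition and `K`
is the whole space. -/
lemma multiplier_of_odd (h2 : (2 : F) ≠ 0) {z : L} (hz : z ∈ gr (F := F) 1) (hz0 : z ≠ 0)
    (hL : ∀ u v : L, ∃ c : F, br (F := F) u v = c • z) {x y : L} (hxy : br (F := F) x y = z)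
    (hf : ∀ f ∈ cocycles F L, ∀ w, f w z = 0)
    (P : FreePresentation.{w} F L) : FiniteDimensional F P.Multiplier ∧ P.s = 3 := by
  obtain ⟨ζ, hζ, hζz⟩ := exists_homogeneous_dual hz hz0
  obtain ⟨hfin, hs⟩ := multiplier_of_derived_eq_span h2 hz hz0 (derived_eq_span hL hxy) hζ hζz
    (K := ⊤) (fun w hw => .inl rfl)
    (fun f hfs => ⟨fun h w _ => hf f h w, fun h =>
      mem_cocycles_of_forall_apply_eq_zero hfs hL fun w => h w trivial⟩) P
  refine ⟨hfin, ?_⟩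
  rw [hs, finrank_top]
  ring

/-- With a single pair `(x, y)`, the triple `(x, y, y)` gives `2 f y z = 0`, and the triples `(x, y,
w)` then give `f w z = 0` on `ker X`. Nothing constrains `f x z`, so `K = ker X` is a hyperplane. -/
lemma multiplier_of_odd_of_rank_one (h2 : (2 : F) ≠ 0) {z : L} (hz : z ∈ gr (F := F) 1)
    (hz0 : z ≠ 0) {X Y : L →ₗ[F] F} (hX : ∀ u ∈ gr (F := F) (L := L) 1, X u = 0)
    (hY : ∀ u ∈ gr (F := F) (L := L) 0, Y u = 0)
    (hL : ∀ u v : L, br (F := F) u v = (X u * Y v - Y u * X v) • z)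
    {x y : L} (hx : x ∈ gr (F := F) 0) (hy : y ∈ gr (F := F) 1) (hXx : X x = 1) (hYy : Y y = 1)
    (P : FreePresentation.{w} F L) : FiniteDimensional F P.Multiplier ∧ P.s = 2 := by
  have hXy := hX y hy
  have hYx := hY x hx
  have hxy : br (F := F) x y = z := by rw [hL]; simp [hXx, hYy, hXy]
  obtain ⟨ζ, hζ, hζz⟩ := exists_homogeneous_dual hz hz0
  have hK : ∀ f ∈ superSkew F L, f ∈ cocycles F L ↔ ∀ w ∈ LinearMap.ker X, f w z = 0 := by
    refine fun f hfs => ⟨fun h => ?_, fun h => ⟨hfs, fun a b c u v w hu hv hw => ?_⟩⟩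
    · have hyz : f y z = 0 := by
        have := h.2 0 1 1 x y y hx hy hy
        simp only [hL, hXx, hYy, hXy, hYx, ZMod.val_zero, ZMod.val_one] at this
        have h' : 2 * f y z = 0 := by
          simp at this
          linear_combination -this
        exact (mul_eq_zero.1 h').resolve_left h2
      have key (a : ZMod 2) (w : L) (hw : w ∈ gr (F := F) a) (hXw : X w = 0) : f w z = 0 :=
        cocycle_apply_eq_zero_of_pair h hx hy hw hxy (hL y w) (hL w x)
          (by simp [hXw, hXy]) (by simp [hyz])
      intro w hw
      replace hw : X w = 0 := hw
      have h1 : X (grProj F L 1 w) = 0 := hX _ (grProj_mem 1 w)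
      have h0 : X (grProj F L 0 w) = 0 := by
        rw [← hw]
        conv_rhs => rw [← grProj_add (F := F) w, map_add, h1, add_zero]
      rw [← grProj_add (F := F) w, map_add, LinearMap.add_apply, key 0 _ (grProj_mem 0 w) h0,
        key 1 _ (grProj_mem 1 w) h1, add_zero]
    -- Vanishing on `ker X` makes `f · z` a multiple of `X`. In each parity case every vector loses
    -- its `X` or its `Y`, and the cocycle identity becomes polynomial.
    · have hfz (u : L) : f u z = X u * f x z := by
        have := h (u - X u • x) (by simp [hXx])
        simpa [sub_eq_zero] using this
      simp only [hL, map_smul, smul_eq_mul, hfz u, hfz v, hfz w]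
      obtain rfl | rfl := zmod_two_cases a <;> obtain rfl | rfl := zmod_two_cases b <;>
        obtain rfl | rfl := zmod_two_cases c <;>
        first
          | rw [hX u hu] | rw [hY u hu]
      all_goals first
          | rw [hX v hv] | rw [hY v hv]
      all_goals first
          | rw [hX w hw] | rw [hY w hw]
      all_goals simp only [ZMod.val_zero, ZMod.val_one]; ring
  obtain ⟨hfin, hs⟩ := multiplier_of_derived_eq_span h2 hz hz0
    (derived_eq_span (fun u v => ⟨_, hL u v⟩) hxy) hζ hζz
    (fun w hw => .inl rfl) hK P
  refine ⟨hfin, ?_⟩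
  rw [hs, ← finrank_ker_add_one hXx]
  push_cast
  ring

end Invariant

/-! ### Isomorphisms and coordinates in the Heisenberg models. -/

section Models

variable {F : Type*} [Field F]

section Iso

variable {L : Type*} [AddCommGroup L] [Module F L] [LieSuperalgebra F L]
  {M : Type*} [AddCommGroup M] [Module F M] [LieSuperalgebra F M] (e : Iso F L M)

/-- The homomorphism underlying an isomorphism. -/
def Iso.toHom : Hom F L M where
  toLinearMap := e.toLinearEquiv.toLinearMap
  map_gr := e.map_gr
  map_br := e.map_br

/-- Evenness is assumed only in the forward direction; since an even map commutes with the
homogeneous projections, injectivity passes it to the inverse. -/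
lemma iso_symm_mem_gr {a : ZMod 2} {y : M} (hy : y ∈ gr (F := F) a) :
    e.toLinearEquiv.symm y ∈ gr (F := F) (L := L) a := by
  have h := hom_grProj e.toHom a (e.toLinearEquiv.symm y)
  have h' : e.toHom.toLinearMap (e.toLinearEquiv.symm y) = y :=
    e.toLinearEquiv.apply_symm_apply y
  rw [h', grProj_self hy] at h
  have : grProj F L a (e.toLinearEquiv.symm y) = e.toLinearEquiv.symm y :=
    e.toLinearEquiv.injective (h.trans h'.symm)
  rw [← this]
  exact grProj_mem a _

lemma iso_symm_br (x y : M) : e.toLinearEquiv.symm (br (F := F) x y) =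
    br (F := F) (e.toLinearEquiv.symm x) (e.toLinearEquiv.symm y) := by
  rw [LinearEquiv.symm_apply_eq]
  refine Eq.trans ?_ (e.map_br _ _).symm
  exact congrArg₂ (fun u v => br (F := F) u v) (e.toLinearEquiv.apply_symm_apply x).symm
    (e.toLinearEquiv.apply_symm_apply y).symm

end Iso

variable {p q a b : ℕ}

/-- The vector of `H(p, q) ⊕ A(a ∣ b)` with the given coordinates in `H(p, q)`. -/
def heisEvenVec (u v : Fin p → F) (c : F) (w : Fin q → F) : HeisEven F p q × Abelian F a b :=
  (((u, v, c), w), 0)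

lemma br_heisEven (x y : HeisEven F p q × Abelian F a b) : br (F := F) x y =
    (x.1.1.1 ⬝ᵥ y.1.1.2.1 - x.1.1.2.1 ⬝ᵥ y.1.1.1 + x.1.2 ⬝ᵥ y.1.2) •
      heisEvenVec (0 : Fin p → F) 0 (1 : F) (0 : Fin q → F) := by
  refine Prod.ext (Prod.ext (Prod.ext ?_ (Prod.ext ?_ ?_)) ?_) ?_
  · exact (smul_zero _).symm
  · exact (smul_zero _).symm
  · exact (mul_one _).symm
  · exact (smul_zero _).symm
  · exact (smul_zero _).symm

/-- The vector of `H_p ⊕ A(a ∣ b)` with the given coordinates in `H_p`. -/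
def heisOddVec (u v : Fin p → F) (c : F) : HeisOdd F p × Abelian F a b :=
  ((u, (v, c)), 0)

lemma br_heisOdd (x y : HeisOdd F p × Abelian F a b) : br (F := F) x y =
    (x.1.1 ⬝ᵥ y.1.2.1 - x.1.2.1 ⬝ᵥ y.1.1) • heisOddVec (0 : Fin p → F) 0 (1 : F) := by
  refine Prod.ext (Prod.ext ?_ (Prod.ext ?_ ?_)) ?_
  · exact (smul_zero _).symm
  · exact (smul_zero _).symm
  · exact (mul_one _).symm
  · exact (smul_zero _).symm

end Models

/-! ### Multipliers of the Heisenberg models. -/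

section ModelMultipliers

universe w

variable {F : Type*} [Field F] {p q a b : ℕ}
  {L : Type*} [AddCommGroup L] [Module F L] [LieSuperalgebra F L]

lemma heisEvenVec_mem_gr_zero (u v : Fin p → F) (c : F) :
    (heisEvenVec u v c (0 : Fin q → F) : HeisEven F p q × Abelian F a b) ∈ gr (F := F) 0 :=
  ⟨(mem_stdGr_zero F _).2 rfl, Submodule.zero_mem _⟩

lemma heisEvenVec_mem_gr_one (w : Fin q → F) :
    (heisEvenVec (0 : Fin p → F) 0 (0 : F) w : HeisEven F p q × Abelian F a b) ∈
      gr (F := F) 1 :=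
  ⟨(mem_stdGr_one F _).2 rfl, Submodule.zero_mem _⟩

lemma br_heisEvenVec (u v u' v' : Fin p → F) (c c' : F) (w w' : Fin q → F) :
    br (F := F) (heisEvenVec u v c w : HeisEven F p q × Abelian F a b)
      (heisEvenVec u' v' c' w') =
    (u ⬝ᵥ v' - v ⬝ᵥ u' + w ⬝ᵥ w') • heisEvenVec (0 : Fin p → F) 0 (1 : F) (0 : Fin q → F) :=
  br_heisEven _ _

lemma heisEvenVec_ne_zero :
    (heisEvenVec (0 : Fin p → F) 0 (1 : F) (0 : Fin q → F) : HeisEven F p q × Abelian F a b) ≠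
      0 :=
  fun h => one_ne_zero (α := F)
    (congrArg (fun x : HeisEven F p q × Abelian F a b => x.1.1.2.2) h)

variable (F p q a b) in
/-- The first vectors of the pairs `(xᵢ, xₚ₊ᵢ)` and `(yⱼ, yⱼ)`. -/
def heisEvenFst : Fin p ⊕ Fin q → HeisEven F p q × Abelian F a b :=
  Sum.elim (fun i => heisEvenVec (Pi.single i 1) 0 0 0) fun j => heisEvenVec 0 0 0 (Pi.single j 1)

variable (F p q a b) in
/-- The second vectors of the pairs `(xᵢ, xₚ₊ᵢ)` and `(yⱼ, yⱼ)`. -/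
def heisEvenSnd : Fin p ⊕ Fin q → HeisEven F p q × Abelian F a b :=
  Sum.elim (fun i => heisEvenVec 0 (Pi.single i 1) 0 0) fun j => heisEvenVec 0 0 0 (Pi.single j 1)

lemma exists_heisEvenFst_mem (k : Fin p ⊕ Fin q) :
    ∃ d, heisEvenFst F p q a b k ∈ gr (F := F) d := by
  obtain i | j := k
  · exact ⟨0, heisEvenVec_mem_gr_zero _ _ _⟩
  · exact ⟨1, heisEvenVec_mem_gr_one _⟩

lemma exists_heisEvenSnd_mem (k : Fin p ⊕ Fin q) :
    ∃ d, heisEvenSnd F p q a b k ∈ gr (F := F) d := by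
  obtain i | j := k
  · exact ⟨0, heisEvenVec_mem_gr_zero _ _ _⟩
  · exact ⟨1, heisEvenVec_mem_gr_one _⟩

lemma br_heisEvenFst_snd (k : Fin p ⊕ Fin q) :
    br (F := F) (heisEvenFst F p q a b k) (heisEvenSnd F p q a b k) =
      heisEvenVec 0 0 1 0 := by
  obtain i | j := k <;> simp [heisEvenFst, heisEvenSnd, br_heisEvenVec]

/-- The pairs `(xᵢ, xₚ₊ᵢ)` and `(yⱼ, yⱼ)` form one family of `p + q` mutually orthogonal pairs, so
any two of them, of either kind, can be used when `p + q ≥ 2`. -/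
lemma br_heisEven_of_ne {k l : Fin p ⊕ Fin q} (h : k ≠ l) :
    br (F := F) (heisEvenFst F p q a b k) (heisEvenFst F p q a b l) = 0 ∧
    br (F := F) (heisEvenSnd F p q a b k) (heisEvenFst F p q a b l) = 0 ∧
    br (F := F) (heisEvenSnd F p q a b k) (heisEvenSnd F p q a b l) = 0 := by
  obtain i | i := k <;> obtain j | j := l <;>
    simp_all [heisEvenFst, heisEvenSnd, br_heisEvenVec]

lemma multiplier_heisEven [FiniteDimensional F L] (h2 : (2 : F) ≠ 0) (h3 : (3 : F) ≠ 0)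
    (e : Iso F L (HeisEven F p q × Abelian F a b)) (hpq : (p = 0 ∧ q = 1) ∨ 2 ≤ p + q)
    (P : FreePresentation.{w} F L) : FiniteDimensional F P.Multiplier ∧ P.s = 2 := by
  obtain ⟨σ, hσ⟩ : ∃ σ, σ = e.toLinearEquiv.symm := ⟨_, rfl⟩
  have hbr (x y) : σ (br (F := F) x y) = br (F := F) (σ x) (σ y) := by
    rw [hσ]; exact iso_symm_br e x y
  have hgr {d x} (hx : x ∈ gr (F := F) d) : σ x ∈ gr (F := F) (L := L) d := by
    rw [hσ]; exact iso_symm_mem_gr e hx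
  have hL (u v : L) : ∃ c : F, br (F := F) u v = c • σ (heisEvenVec 0 0 1 0) := by
    obtain ⟨u, rfl⟩ := σ.surjective u
    obtain ⟨v, rfl⟩ := σ.surjective v
    exact ⟨_, by rw [← hbr, br_heisEven, map_smul]⟩
  have hpair (k : Fin p ⊕ Fin q) : br (F := F) (σ (heisEvenFst F p q a b k))
      (σ (heisEvenSnd F p q a b k)) = σ (heisEvenVec 0 0 1 0) := by
    rw [← hbr, br_heisEvenFst_snd]
  have : Nonempty (Fin p ⊕ Fin q) := Fintype.card_pos_iff.1 (by simp; omega)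
  refine multiplier_of_even h2 (hgr (heisEvenVec_mem_gr_zero 0 0 1))
    (σ.map_ne_zero_iff.2 heisEvenVec_ne_zero) hL (hpair (Classical.arbitrary _)) (fun f hf => ?_) P
  obtain ⟨rfl, rfl⟩ | hpq := hpq
  · have hy := hgr (heisEvenVec_mem_gr_one (p := 0) (a := a) (b := b) (Pi.single (0 : Fin 1) (1 : F)))
    have hyy := hpair (.inr 0)
    refine fun w => ?_
    have h0 : f (σ (heisEvenVec 0 0 0 (Pi.single 0 1))) (σ (heisEvenVec 0 0 1 0)) = 0 := by
      have := hf.2 1 1 1 _ _ _ hy hy hy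
      rw [show br (F := F) (σ (heisEvenVec 0 0 0 (Pi.single 0 1)))
        (σ (heisEvenVec 0 0 0 (Pi.single 0 1))) = σ (heisEvenVec 0 0 1 0) from hyy] at this
      -- All three terms of the cocycle identity on `(y, y, y)` equal `-f y z`; characteristic
      -- different from `3` is needed here.
      have h' : 3 * f (σ (heisEvenVec 0 0 0 (Pi.single 0 1))) (σ (heisEvenVec 0 0 1 0)) = 0 := by
        simp only [ZMod.val_one] at this
        linear_combination -this
      exact (mul_eq_zero.1 h').resolve_left h3
    exact cocycle_apply_eq_zero_of_forall_pair hf hL hy hy hyy h0 h0 w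
  · have : Nontrivial (Fin p ⊕ Fin q) := Fintype.one_lt_card_iff_nontrivial.1 (by simp; omega)
    obtain ⟨k, l, hkl⟩ := exists_pair_ne (Fin p ⊕ Fin q)
    obtain ⟨h1, h2, -⟩ := br_heisEven_of_ne (F := F) (a := a) (b := b) hkl
    obtain ⟨-, h3, h4⟩ := br_heisEven_of_ne (F := F) (a := a) (b := b) hkl.symm
    obtain ⟨_, hk⟩ := exists_heisEvenFst_mem (F := F) (a := a) (b := b) k
    obtain ⟨_, hk'⟩ := exists_heisEvenSnd_mem (F := F) (a := a) (b := b) k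
    obtain ⟨_, hl⟩ := exists_heisEvenFst_mem (F := F) (a := a) (b := b) l
    obtain ⟨_, hl'⟩ := exists_heisEvenSnd_mem (F := F) (a := a) (b := b) l
    exact cocycle_apply_eq_zero_of_two_pairs hf hL (hgr hk) (hgr hk') (hgr hl) (hgr hl')
      (hpair k) (hpair l) (by rw [← hbr, h1, map_zero]) (by rw [← hbr, h2, map_zero])
      (by rw [← hbr, h3, map_zero]) (by rw [← hbr, h4, map_zero])

lemma heisOddVec_mem_gr_zero (u : Fin p → F) :
    (heisOddVec u 0 (0 : F) : HeisOdd F p × Abelian F a b) ∈ gr (F := F) 0 :=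
  ⟨(mem_stdGr_zero F _).2 rfl, Submodule.zero_mem _⟩

lemma heisOddVec_mem_gr_one (v : Fin p → F) (c : F) :
    (heisOddVec 0 v c : HeisOdd F p × Abelian F a b) ∈ gr (F := F) 1 :=
  ⟨(mem_stdGr_one F _).2 rfl, Submodule.zero_mem _⟩

lemma br_heisOddVec (u v u' v' : Fin p → F) (c c' : F) :
    br (F := F) (heisOddVec u v c : HeisOdd F p × Abelian F a b) (heisOddVec u' v' c') =
    (u ⬝ᵥ v' - v ⬝ᵥ u') • heisOddVec (0 : Fin p → F) 0 (1 : F) :=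
  br_heisOdd _ _

lemma heisOddVec_ne_zero :
    (heisOddVec (0 : Fin p → F) 0 (1 : F) : HeisOdd F p × Abelian F a b) ≠ 0 :=
  fun h => one_ne_zero (α := F) (congrArg (fun x : HeisOdd F p × Abelian F a b => x.1.2.2) h)

lemma multiplier_heisOdd [FiniteDimensional F L] (h2 : (2 : F) ≠ 0)
    (e : Iso F L (HeisOdd F p × Abelian F a b)) (hp : 2 ≤ p)
    (P : FreePresentation.{w} F L) : FiniteDimensional F P.Multiplier ∧ P.s = 3 := by
  obtain ⟨σ, hσ⟩ : ∃ σ, σ = e.toLinearEquiv.symm := ⟨_, rfl⟩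
  have hbr (x y) : σ (br (F := F) x y) = br (F := F) (σ x) (σ y) := by
    rw [hσ]; exact iso_symm_br e x y
  have hgr {d x} (hx : x ∈ gr (F := F) d) : σ x ∈ gr (F := F) (L := L) d := by
    rw [hσ]; exact iso_symm_mem_gr e hx
  have hL (u v : L) : ∃ c : F, br (F := F) u v = c • σ (heisOddVec 0 0 1) := by
    obtain ⟨u, rfl⟩ := σ.surjective u
    obtain ⟨v, rfl⟩ := σ.surjective v
    exact ⟨_, by rw [← hbr, br_heisOdd, map_smul]⟩
  have hpair (i : Fin p) : br (F := F) (σ (heisOddVec (Pi.single i 1) 0 0))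
      (σ (heisOddVec 0 (Pi.single i 1) 0)) = σ (heisOddVec 0 0 1) := by
    simp [← hbr, br_heisOddVec]
  have : Nontrivial (Fin p) := Fin.nontrivial_iff_two_le.2 hp
  obtain ⟨i, j, hij⟩ := exists_pair_ne (Fin p)
  refine multiplier_of_odd h2 (hgr (heisOddVec_mem_gr_one 0 1))
    (σ.map_ne_zero_iff.2 heisOddVec_ne_zero) hL (hpair i) (fun f hf => ?_) P
  refine cocycle_apply_eq_zero_of_two_pairs hf hL (hgr (heisOddVec_mem_gr_zero _))
    (hgr (heisOddVec_mem_gr_one _ _)) (hgr (heisOddVec_mem_gr_zero _))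
    (hgr (heisOddVec_mem_gr_one _ _)) (hpair i) (hpair j) ?_ ?_ ?_ ?_ <;>
  simp [← hbr, br_heisOddVec, hij, hij.symm]

lemma multiplier_heisOdd_one [FiniteDimensional F L] (h2 : (2 : F) ≠ 0)
    (e : Iso F L (HeisOdd F 1 × Abelian F a b))
    (P : FreePresentation.{w} F L) : FiniteDimensional F P.Multiplier ∧ P.s = 2 := by
  obtain ⟨σ, hσ⟩ : ∃ σ, σ = e.toLinearEquiv.symm := ⟨_, rfl⟩
  have hbr (x y) : σ (br (F := F) x y) = br (F := F) (σ x) (σ y) := by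
    rw [hσ]; exact iso_symm_br e x y
  have hgr {d x} (hx : x ∈ gr (F := F) d) : σ x ∈ gr (F := F) (L := L) d := by
    rw [hσ]; exact iso_symm_mem_gr e hx
  let X : L →ₗ[F] F :=
    { toFun := fun u => (e.toLinearEquiv u).1.1 0
      map_add' := fun u v => by rw [map_add]; rfl
      map_smul' := fun c u => by rw [map_smul]; rfl }
  let Y : L →ₗ[F] F :=
    { toFun := fun u => (e.toLinearEquiv u).1.2.1 0
      map_add' := fun u v => by rw [map_add]; rfl
      map_smul' := fun c u => by rw [map_smul]; rfl }
  have hXσ (x) : X (σ x) = x.1.1 0 := by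
    rw [hσ]
    exact congrArg (fun x : HeisOdd F 1 × Abelian F a b => x.1.1 0)
      (e.toLinearEquiv.apply_symm_apply x)
  have hYσ (x) : Y (σ x) = x.1.2.1 0 := by
    rw [hσ]
    exact congrArg (fun x : HeisOdd F 1 × Abelian F a b => x.1.2.1 0)
      (e.toLinearEquiv.apply_symm_apply x)
  refine multiplier_of_odd_of_rank_one h2 (X := X) (Y := Y) (hgr (heisOddVec_mem_gr_one 0 1))
    (σ.map_ne_zero_iff.2 heisOddVec_ne_zero) (fun u hu => ?_) (fun u hu => ?_) (fun u v => ?_)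
    (hgr (heisOddVec_mem_gr_zero 1)) (hgr (heisOddVec_mem_gr_one 1 0)) (hXσ _) (hYσ _) P
  · exact congrFun ((mem_stdGr_one F _).1 (e.map_gr 1 u hu).1) 0
  · exact congrFun (congrArg Prod.fst ((mem_stdGr_zero F _).1 (e.map_gr 0 u hu).1)) 0
  · obtain ⟨u, rfl⟩ := σ.surjective u
    obtain ⟨v, rfl⟩ := σ.surjective v
    rw [← hbr, br_heisOdd, map_smul, hXσ, hXσ, hYσ, hYσ]
    simp [dotProduct]

end ModelMultipliers

/-! ### Structure of nilpotent superalgebras whose derived subalgebra is a line. -/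

section Structure

variable {F : Type*} [Field F]
  {L : Type*} [AddCommGroup L] [Module F L] [LieSuperalgebra F L]

/-- If `[z, w] = c z` with `c ≠ 0`, then `z = [z, c⁻¹ w]` lies in every term of the central series,
hence is zero. -/
lemma br_eq_zero_of_isNilpotent (hnil : IsNilpotent F L) {z : L}
    (hL : ∀ u v : L, ∃ c : F, br (F := F) u v = c • z) (w : L) : br (F := F) z w = 0 := by
  obtain ⟨c, hc⟩ := hL z w
  by_cases hc0 : c = 0
  · rw [hc, hc0, zero_smul]
  have hmem (k : ℕ) : z ∈ centralSeries F L k := by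
    induction k with
    | zero => trivial
    | succ k ih =>
      have h : z = br (F := F) z (c⁻¹ • w) := by
        rw [map_smul, hc, smul_smul, inv_mul_cancel₀ hc0, one_smul]
      rw [h]
      exact Submodule.apply_mem_map₂ _ ih trivial
  obtain ⟨k, hk⟩ := hnil
  have := hmem k
  rw [hk, Submodule.mem_bot] at this
  rw [this, map_zero, LinearMap.zero_apply]

/-- In a nilpotent Lie superalgebra whose derived subalgebra is a line of degree `d`, the bracket
is `B ⊗ z` for a bilinear form `B` of degree `d` and a central element `z`. -/
lemma exists_bilinear_form_of_derived [FiniteDimensional F L] (hnil : IsNilpotent F L)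
    {d : ZMod 2}
    (h1 : Module.finrank F (derived F L ⊓ gr d : Submodule F L) = 1)
    (h0 : Module.finrank F (derived F L ⊓ gr (d + 1) : Submodule F L) = 0) :
    ∃ (z : L) (ζ : L →ₗ[F] F) (B : L →ₗ[F] L →ₗ[F] F), z ∈ gr (F := F) d ∧ ζ z = 1 ∧
      (∀ u v, br (F := F) u v = B u v • z) ∧
      (∀ (a b : ZMod 2) (u v : L), u ∈ gr (F := F) a → v ∈ gr (F := F) b → a + b ≠ d → B u v = 0) ∧
      (∀ (a b : ZMod 2) (u v : L), u ∈ gr (F := F) a → v ∈ gr (F := F) b →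
        B u v = -((-1 : F) ^ (a.val * b.val) * B v u)) ∧
      (∀ w, B z w = 0 ∧ B w z = 0) ∧ B ≠ 0 := by
  obtain ⟨⟨z, hzD, hz⟩, hz0, hzs⟩ := finrank_eq_one_iff'.1 h1
  replace hz0 : z ≠ 0 := fun h => hz0 (Subtype.ext h)
  have hD (a b : ZMod 2) (u v : L) (hu : u ∈ gr (F := F) a) (hv : v ∈ gr (F := F) b) :
      ∃ c : F, br (F := F) u v = c • z := by
    have hm : br (F := F) u v ∈ derived F L := Submodule.apply_mem_map₂ _ trivial trivial
    have hg := br_mem a b u v hu hv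
    by_cases hab : a + b = d
    · obtain ⟨c, hc⟩ := hzs ⟨_, hm, hab ▸ hg⟩
      exact ⟨c, (congrArg Subtype.val hc).symm⟩
    · have hab' : a + b = d + 1 := by
        have key : ∀ a b d : ZMod 2, ¬a + b = d → a + b = d + 1 := by decide
        exact key a b d hab
      have := Submodule.finrank_eq_zero.1 h0
      refine ⟨0, ?_⟩
      rw [zero_smul, ← Submodule.mem_bot F, ← this]
      exact ⟨hm, hab' ▸ hg⟩
  have hL (u v : L) : ∃ c : F, br (F := F) u v = c • z := by
    have hz' (x : L) : (∃ c : F, x = c • z) ↔ x ∈ Submodule.span F {z} := by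
      rw [Submodule.mem_span_singleton]
      exact exists_congr fun c => eq_comm
    simp only [hz'] at hD ⊢
    rw [← grProj_add (F := F) u, ← grProj_add (F := F) v]
    simp only [map_add, LinearMap.add_apply]
    have h (a b : ZMod 2) := hD a b _ _ (grProj_mem a u) (grProj_mem b v)
    exact add_mem (add_mem (h _ _) (h _ _)) (add_mem (h _ _) (h _ _))
  obtain ⟨ζ, hζ, hζz⟩ := exists_homogeneous_dual hz hz0
  have hB (u v : L) : br (F := F) u v = ζ (br (F := F) u v) • z := by
    obtain ⟨c, hc⟩ := hL u v
    rw [hc, map_smul, hζz, smul_eq_mul, mul_one]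
  have hcomm (a b : ZMod 2) (u v : L) (hu : u ∈ gr (F := F) a) (hv : v ∈ gr (F := F) b) :
      ζ (br (F := F) u v) = -((-1 : F) ^ (a.val * b.val) * ζ (br (F := F) v u)) := by
    rw [br_skew a b u v hu hv, map_neg, map_smul, smul_eq_mul]
  have hzw := br_eq_zero_of_isNilpotent hnil hL
  refine ⟨z, ζ, (br (F := F)).compr₂ ζ, hz, hζz, hB, fun a b u v hu hv hab =>
    hζ _ _ (br_mem a b u v hu hv) hab, hcomm, fun w => ⟨?_, ?_⟩, fun h => ?_⟩
  · rw [LinearMap.compr₂_apply, hzw, map_zero]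
  · refine gr_induction F (p := fun w => ζ (br (F := F) w z) = 0) w (fun a w hw => ?_)
      fun x y hx hy => ?_
    · rw [hcomm a d w z hw hz, hzw, map_zero, mul_zero, neg_zero]
    · simp only [map_add, LinearMap.add_apply, hx, hy, add_zero]
  · have hbot : derived F L = ⊥ := by
      refine le_bot_iff.1 (Submodule.map₂_le.2 fun u _ v _ => ?_)
      have : ζ (br (F := F) u v) = 0 := LinearMap.congr_fun₂ h u v
      rw [hB, this, zero_smul]
      exact Submodule.zero_mem _
    rw [hbot] at hzD
    exact hz0 hzD

/-- The decomposition of a vector into its homogeneous components. -/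
noncomputable def grEquiv : L ≃ₗ[F] gr (F := F) (L := L) 0 × gr (F := F) (L := L) 1 :=
  (Submodule.prodEquivOfIsCompl _ _ isCompl_gr).symm

lemma grEquiv_add (x : L) : ((grEquiv (F := F) x).1 : L) + (grEquiv (F := F) x).2 = x :=
  (Submodule.prodEquivOfIsCompl _ _ (isCompl_gr (F := F) (L := L))).apply_symm_apply x

lemma grEquiv_snd_eq_zero {x : L} (hx : x ∈ gr (F := F) 0) : (grEquiv (F := F) x).2 = 0 :=
  (Submodule.prodEquivOfIsCompl_symm_apply_snd_eq_zero _ _ _).2 hx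

lemma grEquiv_fst_eq_zero {x : L} (hx : x ∈ gr (F := F) 1) : (grEquiv (F := F) x).1 = 0 :=
  (Submodule.prodEquivOfIsCompl_symm_apply_fst_eq_zero _ _ _).2 hx

lemma grEquiv_fst_of_mem {x : L} (hx : x ∈ gr (F := F) 0) : (grEquiv (F := F) x).1 = ⟨x, hx⟩ := by
  have := grEquiv_add (F := F) x
  rw [grEquiv_snd_eq_zero hx] at this
  exact Subtype.ext (by simpa using this)

lemma grEquiv_snd_of_mem {x : L} (hx : x ∈ gr (F := F) 1) : (grEquiv (F := F) x).2 = ⟨x, hx⟩ := by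
  have := grEquiv_add (F := F) x
  rw [grEquiv_fst_eq_zero hx] at this
  exact Subtype.ext (by simpa using this)

/-- The normal forms of `B` on the two parts provide the `x` and `y` coordinates, and `ζ` provides
the coordinate of `z`. Since `B` factors through these coordinates, the remaining directions are
central and make up the abelian summand. -/
lemma exists_iso_heisEven [FiniteDimensional F L] (h2 : (2 : F) ≠ 0) (hsq : ∀ c : F, IsSquare c)
    (hnil : IsNilpotent F L) {m n : ℕ} (hdim : HasSuperdim F (⊤ : Submodule F L) m n)
    (hder : HasSuperdim F (derived F L) 1 0) :
    ∃ p q : ℕ, 1 ≤ p + q ∧ 2 * p + 1 ≤ m ∧ q ≤ n ∧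
      Nonempty (Iso F L (HeisEven F p q × Abelian F (m - 2 * p - 1) (n - q))) := by
  obtain ⟨hm, hn⟩ := hdim
  rw [top_inf_eq] at hm hn
  obtain ⟨z, ζ, B, hz, hζz, hB, hBdeg, hBskew, hBz, hB0⟩ :=
    exists_bilinear_form_of_derived hnil hder.1 hder.2
  obtain ⟨p, X, Y, hXY, hBXY⟩ := exists_alternating_normal_form
    (B.domRestrict₁₂ (gr (F := F) 0) (gr (F := F) 0)) fun u => by
      have := hBskew 0 0 u u u.2 u.2
      simp only [ZMod.val_zero, mul_zero, pow_zero, one_mul] at this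
      rw [eq_neg_iff_add_eq_zero, ← two_mul] at this
      exact (mul_eq_zero.1 this).resolve_left h2
  obtain ⟨q, W, hW, hBW⟩ := exists_symmetric_normal_form h2 hsq
    (B.domRestrict₁₂ (gr (F := F) 1) (gr (F := F) 1)) fun u v => by
      have := hBskew 1 1 u v u.2 v.2
      simpa [ZMod.val_one, LinearMap.domRestrict₁₂_apply] using this
  have hXYz : X ⟨z, hz⟩ = 0 ∧ Y ⟨z, hz⟩ = 0 := by
    refine eq_zero_of_forall_dotProduct_sub fun c d => ?_
    obtain ⟨v, hv⟩ := hXY (c, d)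
    replace hv : X v = c ∧ Y v = d := Prod.ext_iff.1 hv
    rw [← hv.1, ← hv.2, ← hBXY]
    exact (hBz v).1
  let G : gr (F := F) (L := L) 0 →ₗ[F] (Fin p → F) × (Fin p → F) × F :=
    X.prod (Y.prod (ζ ∘ₗ (gr 0).subtype))
  have hGz : G ⟨z, hz⟩ = (0, 0, 1) := Prod.ext hXYz.1 (Prod.ext hXYz.2 hζz)
  have hG : Function.Surjective G := by
    rintro ⟨c, d, t⟩
    obtain ⟨v, hv⟩ := hXY (c, d)
    replace hv : X v = c ∧ Y v = d := Prod.ext_iff.1 hv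
    -- `X` and `Y` kill `z` while `ζ z = 1`, so a multiple of `z` corrects the last coordinate only.
    refine ⟨v + (t - ζ v) • ⟨z, hz⟩, ?_⟩
    have hGv : G v = (c, d, ζ v) := Prod.ext hv.1 (Prod.ext hv.2 rfl)
    rw [map_add, map_smul, hGz, hGv]
    simp
  have hdU : Module.finrank F ((Fin p → F) × (Fin p → F) × F) = 2 * p + 1 := by
    simp; ring
  have hpm : 2 * p + 1 ≤ m := by
    rw [← hm, ← hdU]; exact LinearMap.finrank_le_finrank_of_surjective hG
  have hqn : q ≤ n := by
    rw [← hn, ← Module.finrank_fin_fun F (n := q)]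
    exact LinearMap.finrank_le_finrank_of_surjective hW
  -- Prescribing `z` to have no abelian component makes its image exactly the model's central
  -- vector.
  obtain ⟨e₀, he₀, he₀z⟩ := exists_equiv_prod_of_surjective G hG ⟨z, hz⟩
    (fun h => by simp [hGz] at h) (m - 2 * p - 1) (by rw [hm, hdU]; omega)
  obtain ⟨e₁, he₁, -⟩ := exists_equiv_prod_of_surjective W hW 0 (fun _ => rfl) (n - q)
    (by rw [hn, Module.finrank_fin_fun])
  have hBadd (u v : L) : B u v =
      X (grEquiv (F := F) u).1 ⬝ᵥ Y (grEquiv (F := F) v).1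
        - Y (grEquiv (F := F) u).1 ⬝ᵥ X (grEquiv (F := F) v).1
        + W (grEquiv (F := F) u).2 ⬝ᵥ W (grEquiv (F := F) v).2 := by
    rw [← hBXY, ← hBW]
    conv_lhs => rw [← grEquiv_add (F := F) u, ← grEquiv_add (F := F) v]
    simp only [map_add, LinearMap.add_apply, LinearMap.domRestrict₁₂_apply]
    rw [hBdeg 0 1 _ _ (Subtype.prop _) (Subtype.prop _) (by decide),
      hBdeg 1 0 _ _ (Subtype.prop _) (Subtype.prop _) (by decide)]
    ring
  let E : L ≃ₗ[F] HeisEven F p q × Abelian F (m - 2 * p - 1) (n - q) :=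
    (grEquiv.trans (e₀.prodCongr e₁)).trans (LinearEquiv.prodProdProdComm F _ _ _ _)
  have hE (x : L) : E x = (((e₀ (grEquiv (F := F) x).1).1, (e₁ (grEquiv (F := F) x).2).1),
      ((e₀ (grEquiv (F := F) x).1).2, (e₁ (grEquiv (F := F) x).2).2)) := rfl
  have hEz : E z = heisEvenVec 0 0 1 0 := by
    rw [hE, grEquiv_fst_of_mem hz, grEquiv_snd_eq_zero hz, he₀, he₀z, hGz, map_zero]
    rfl
  refine ⟨p, q, ?_, hpm, hqn, ⟨⟨E, fun a x hx => ?_, fun x y => ?_⟩⟩⟩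
  · by_contra! h
    obtain ⟨rfl, rfl⟩ : p = 0 ∧ q = 0 := by omega
    exact hB0 (LinearMap.ext₂ fun u v => by rw [hBadd]; simp)
  · change E x ∈ _
    obtain rfl | rfl := zmod_two_cases a
    · refine ⟨(mem_stdGr_zero F _).2 ?_, (mem_stdGr_zero F _).2 ?_⟩ <;>
      rw [hE, grEquiv_snd_eq_zero hx, map_zero] <;> rfl
    · refine ⟨(mem_stdGr_one F _).2 ?_, (mem_stdGr_one F _).2 ?_⟩ <;>
      rw [hE, grEquiv_fst_eq_zero hx, map_zero] <;> rfl
  · change E (br (F := F) x y) = br (F := F) (E x) (E y)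
    rw [hB, map_smul, hEz, br_heisEven, hBadd, hE, hE]
    simp only [he₀, he₁]
    rfl

/-- For odd `z` the form has degree one, so it is the pairing of the even part with the odd part,
its other half being given by skew-symmetry. No square roots are needed. -/
lemma exists_iso_heisOdd [FiniteDimensional F L]
    (hnil : IsNilpotent F L) {m n : ℕ} (hdim : HasSuperdim F (⊤ : Submodule F L) m n)
    (hder : HasSuperdim F (derived F L) 0 1) :
    ∃ p : ℕ, 1 ≤ p ∧ p ≤ m ∧ p + 1 ≤ n ∧
      Nonempty (Iso F L (HeisOdd F p × Abelian F (m - p) (n - p - 1))) := by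
  obtain ⟨hm, hn⟩ := hdim
  rw [top_inf_eq] at hm hn
  obtain ⟨z, ζ, B, hz, hζz, hB, hBdeg, hBskew, hBz, hB0⟩ :=
    exists_bilinear_form_of_derived (d := 1) hnil hder.2 hder.1
  obtain ⟨p, X, Y, hX, hY, hBXY⟩ := exists_pairing_normal_form
    (B.domRestrict₁₂ (gr (F := F) 0) (gr (F := F) 1))
  have hYz : Y ⟨z, hz⟩ = 0 := by
    refine dotProduct_eq_zero _ fun c => ?_
    obtain ⟨v, rfl⟩ := hX c
    rw [dotProduct_comm, ← hBXY]
    exact (hBz v).2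
  let G : gr (F := F) (L := L) 1 →ₗ[F] (Fin p → F) × F := Y.prod (ζ ∘ₗ (gr 1).subtype)
  have hGz : G ⟨z, hz⟩ = (0, 1) := Prod.ext hYz hζz
  have hG : Function.Surjective G := by
    rintro ⟨c, t⟩
    obtain ⟨v, hv⟩ := hY c
    refine ⟨v + (t - ζ v) • ⟨z, hz⟩, ?_⟩
    have hGv : G v = (c, ζ v) := Prod.ext hv rfl
    rw [map_add, map_smul, hGz, hGv]
    simp
  have hdU : Module.finrank F ((Fin p → F) × F) = p + 1 := by simp
  have hpm : p ≤ m := by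
    rw [← hm, ← Module.finrank_fin_fun F (n := p)]
    exact LinearMap.finrank_le_finrank_of_surjective hX
  have hpn : p + 1 ≤ n := by
    rw [← hn, ← hdU]; exact LinearMap.finrank_le_finrank_of_surjective hG
  obtain ⟨e₀, he₀, -⟩ := exists_equiv_prod_of_surjective X hX 0 (fun _ => rfl) (m - p)
    (by rw [hm, Module.finrank_fin_fun])
  obtain ⟨e₁, he₁, he₁z⟩ := exists_equiv_prod_of_surjective G hG ⟨z, hz⟩
    (fun h => by simp [hGz] at h) (n - p - 1) (by rw [hn, hdU]; omega)
  have hBadd (u v : L) : B u v =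
      X (grEquiv (F := F) u).1 ⬝ᵥ Y (grEquiv (F := F) v).2
        - Y (grEquiv (F := F) u).2 ⬝ᵥ X (grEquiv (F := F) v).1 := by
    rw [dotProduct_comm (Y _), ← hBXY, ← hBXY]
    conv_lhs => rw [← grEquiv_add (F := F) u, ← grEquiv_add (F := F) v]
    simp only [map_add, LinearMap.add_apply, LinearMap.domRestrict₁₂_apply]
    rw [hBdeg 0 0 _ _ (Subtype.prop _) (Subtype.prop _) (by decide),
      hBdeg 1 1 _ _ (Subtype.prop _) (Subtype.prop _) (by decide),
      hBskew 1 0 _ _ (Subtype.prop _) (Subtype.prop _)]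
    simp only [ZMod.val_zero, mul_zero, pow_zero, one_mul]
    ring
  let E : L ≃ₗ[F] HeisOdd F p × Abelian F (m - p) (n - p - 1) :=
    (grEquiv.trans (e₀.prodCongr e₁)).trans (LinearEquiv.prodProdProdComm F _ _ _ _)
  have hE (x : L) : E x = (((e₀ (grEquiv (F := F) x).1).1, (e₁ (grEquiv (F := F) x).2).1),
      ((e₀ (grEquiv (F := F) x).1).2, (e₁ (grEquiv (F := F) x).2).2)) := rfl
  have hEz : E z = heisOddVec 0 0 1 := by
    rw [hE, grEquiv_snd_of_mem hz, grEquiv_fst_eq_zero hz, he₁, he₁z, hGz, map_zero]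
    rfl
  refine ⟨p, ?_, hpm, hpn, ⟨⟨E, fun a x hx => ?_, fun x y => ?_⟩⟩⟩
  · by_contra! h
    obtain rfl : p = 0 := by omega
    exact hB0 (LinearMap.ext₂ fun u v => by rw [hBadd]; simp)
  · change E x ∈ _
    obtain rfl | rfl := zmod_two_cases a
    · refine ⟨(mem_stdGr_zero F _).2 ?_, (mem_stdGr_zero F _).2 ?_⟩ <;>
      rw [hE, grEquiv_snd_eq_zero hx, map_zero] <;> rfl
    · refine ⟨(mem_stdGr_one F _).2 ?_, (mem_stdGr_one F _).2 ?_⟩ <;>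
      rw [hE, grEquiv_fst_eq_zero hx, map_zero] <;> rfl
  · change E (br (F := F) x y) = br (F := F) (E x) (E y)
    rw [hB, map_smul, hEz, br_heisOdd, hBadd, hE, hE]
    simp only [he₀, he₁]
    rfl

end Structure

end LieSuperalgebra

open LieSuperalgebra in
theorem mainTheorem4 {F : Type*} [Field F] (h2 : (2 : F) ≠ 0) (h3 : (3 : F) ≠ 0)
    {L : Type*} [AddCommGroup L] [Module F L] [FiniteDimensional F L] [LieSuperalgebra F L]
    (m n : ℕ) (hdim : HasSuperdim F (⊤ : Submodule F L) m n)
    (hnil : LieSuperalgebra.IsNilpotent F L) :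
    (HasSuperdim F (derived F L) 1 0 →
      ((∀ c : F, IsSquare c) → ∃ p q : ℕ, 1 ≤ p + q ∧ 2 * p + 1 ≤ m ∧ q ≤ n ∧
        Nonempty (Iso F L (HeisEven F p q × Abelian F (m - 2 * p - 1) (n - q)))) ∧
      (∀ p q : ℕ, 2 * p + 1 ≤ m → q ≤ n →
        Nonempty (Iso F L (HeisEven F p q × Abelian F (m - 2 * p - 1) (n - q))) →
        ((p = 0 ∧ q = 1) ∨ 2 ≤ p + q) →
        ∀ P : FreePresentation F L, FiniteDimensional F P.Multiplier ∧ P.s = 2)) ∧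
    (HasSuperdim F (derived F L) 0 1 →
      (∃ p : ℕ, 1 ≤ p ∧ p ≤ m ∧ p + 1 ≤ n ∧
        Nonempty (Iso F L (HeisOdd F p × Abelian F (m - p) (n - p - 1)))) ∧
      (∀ p : ℕ, p ≤ m → p + 1 ≤ n →
        Nonempty (Iso F L (HeisOdd F p × Abelian F (m - p) (n - p - 1))) →
        ∀ P : FreePresentation F L, FiniteDimensional F P.Multiplier ∧
          (2 ≤ p → P.s = 3) ∧ (p = 1 → P.s = 2))) := by
  refine ⟨fun hder => ⟨fun hsq => exists_iso_heisEven h2 hsq hnil hdim hder, ?_⟩,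
    fun hder => ⟨exists_iso_heisOdd hnil hdim hder, ?_⟩⟩
  · rintro p q - - ⟨e⟩ hpq P
    exact multiplier_heisEven h2 h3 e hpq P
  · rintro p - - ⟨e⟩ P
    -- Finite-dimensionality comes from the general exact sequence, so no case distinction on `p` is
    -- needed for it.
    refine ⟨P.finrank_multiplier_add.1, fun hp => (multiplier_heisOdd h2 e hp P).2, ?_⟩
    rintro rfl
    exact (multiplier_heisOdd_one h2 e P).2
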